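/- Let $\omega=e^{2\pi i/6}$. Let $F$ be a fullerene, i.e. a connected cubic graph embedded in the sphere all of whose faces are pentagons and hexagons, and let $T$ be the dual triangulation, regarded as a surface tiled by unit equilateral triangles. A master polyhedron of $F$ is a decomposition of this surface into facets, each of which unfolds to a convex polygon (for instance a triangle) in the Eisenstein plane with corners in $\mathbb Z[\omega]$; the corners of the facets are the centres of the pentagons of $F$, and a facet contains no other pentagon centre. The sides of the facets are the master edges. Nonnegative integers $a,b$ are Coxeter coordinates of a master edge if its vector in the unfolded facet is $\omega^k(a+b\omega)$ for some $k$. The Goldberg–Coxeter transformation $(1,1)$ (leapfrog transformation) replaces each triangle of the dual triangulation of a fullerene by the triangular patch with side vector $1+\omega$; a leapfrog fullerene is a fullerene obtained in this way from a fullerene. Theorem. Let $P$ be a master polyhedron of a fullerene $F$. Then $F$ is a leapfrog fullerene if and only if for every master edge of $P$ its two Coxeter coordinates $a,b$ satisfy $a\equiv b \pmod 3$. -/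

import Mathlib

/-! ### Fullerenes as plane cubic maps -/

/-- A cubic map: a finite cubic graph embedded in a closed oriented surface, given by its darts
(half-bonds).  `flip` exchanges the two darts of a bond; `vert` turns a dart counterclockwise to the
next dart at the same atom.  Dually, a dart is an oriented edge of the dual triangulation, namely
the one that crosses the bond and has the atom of the dart on its left: `flip` reverses it, and
`vert` goes to the next edge around the triangle on its left. -/
structure CubicMap where
  Dart : Type
  finite : Finite Dart
  flip : Equiv.Perm Dart
  vert : Equiv.Perm Dart
  flip_flip : ∀ d, flip (flip d) = d
  flip_ne : ∀ d, flip d ≠ d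
  vert_vert_vert : ∀ d, vert (vert (vert d)) = d
  vert_ne : ∀ d, vert d ≠ d

namespace CubicMap

/-- The permutation whose cycles are the faces of the cubic map.  In the dual triangulation it turns
an oriented edge counterclockwise to the next one with the same initial vertex. -/
def ring (F : CubicMap) : Equiv.Perm F.Dart := F.flip * F.vert⁻¹

/-- The number of bonds of the face that is (in the dual) the initial vertex of the dart `d`. -/
noncomputable def faceSize (F : CubicMap) (d : F.Dart) : ℕ := Function.minimalPeriod F.ring d

/-- The number of cycles of a permutation, fixed points included. -/
noncomputable def cycleCount {α : Type} (σ : Equiv.Perm α) : ℕ :=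
  Nat.card (Quotient (Equiv.Perm.SameCycle.setoid σ))

/-- A fullerene: a nonempty connected cubic map on the sphere (Euler's formula) all of whose faces
are pentagons and hexagons. -/
structure IsFullerene (F : CubicMap) : Prop where
  nonempty : Nonempty F.Dart
  connected : ∀ d d' : F.Dart, ∃ g ∈ Subgroup.closure {F.flip, F.vert}, g d = d'
  euler : cycleCount F.vert + cycleCount F.ring = cycleCount F.flip + 2
  faces : ∀ d, F.faceSize d = 5 ∨ F.faceSize d = 6

/-- Isomorphism of (oriented) cubic maps. -/
structure Iso (F G : CubicMap) where
  toEquiv : F.Dart ≃ G.Dart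
  map_flip : ∀ d, toEquiv (F.flip d) = G.flip (toEquiv d)
  map_vert : ∀ d, toEquiv (F.vert d) = G.vert (toEquiv d)

/-- The bond involution of the leapfrog map; see `leapfrog`. -/
def leapfrogFlip (F : CubicMap) : F.Dart × Fin 3 → F.Dart × Fin 3
  | (d, 0) => (F.ring⁻¹ d, 2)
  | (d, 1) => (F.flip d, 1)
  | (d, 2) => (F.ring d, 0)

theorem leapfrogFlip_leapfrogFlip (F : CubicMap) (x : F.Dart × Fin 3) :
    F.leapfrogFlip (F.leapfrogFlip x) = x := by
  obtain ⟨d, i⟩ := x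
  fin_cases i <;> simp [leapfrogFlip, F.flip_flip]

/-- The Goldberg-Coxeter transformation `(1,1)`, also called the leapfrog transformation: every
triangle of the dual triangulation is replaced by the patch `(1,1)`, the equilateral lattice triangle
with side vector `1 + ω`.  The only lattice points of that patch are its corners and its centre, so
the new triangulation has as vertices the old vertices and the centres of the old triangles.  For
every old oriented edge `d`, from `z` to `z'`, with the centres `l` on its left and `r` on its right,
it has the triangle `z, r, l`, with the oriented edges `(d, 0)` from `z` to `r`, `(d, 1)` from `r`
to `l` and `(d, 2)` from `l` to `z`. -/
def leapfrog (F : CubicMap) : CubicMap where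
  Dart := F.Dart × Fin 3
  finite := by
    have := F.finite
    infer_instance
  flip :=
    { toFun := F.leapfrogFlip
      invFun := F.leapfrogFlip
      left_inv := F.leapfrogFlip_leapfrogFlip
      right_inv := F.leapfrogFlip_leapfrogFlip }
  vert :=
    { toFun := fun x => (x.1, x.2 + 1)
      invFun := fun x => (x.1, x.2 - 1)
      left_inv := fun x => by simp
      right_inv := fun x => by simp }
  flip_flip := F.leapfrogFlip_leapfrogFlip
  flip_ne := by
    rintro ⟨d, i⟩
    fin_cases i <;> simp [leapfrogFlip, F.flip_ne]
  vert_vert_vert := by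
    rintro ⟨d, i⟩
    fin_cases i <;> rfl
  vert_ne := by
    rintro ⟨d, i⟩
    fin_cases i <;> simp

/-- A leapfrog fullerene: one that is obtained from a fullerene by the leapfrog transformation. -/
def IsLeapfrog (F : CubicMap) : Prop :=
  ∃ G : CubicMap, G.IsFullerene ∧ Nonempty (Iso F G.leapfrog)

end CubicMap

/-! ### The Eisenstein plane

With `ω = exp (2πi/6)`, the Eisenstein integer `a + b ω` is written `(a, b) : ℤ × ℤ`, and the point
`x + y ω` of the plane is written `(x, y) : ℝ × ℝ`. -/

namespace Eisenstein

/-- Multiplication by `ω`: as `ω² = ω - 1`, one has `ω (a + b ω) = -b + (a + b) ω`. -/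
def rot (z : ℤ × ℤ) : ℤ × ℤ := (-z.2, z.1 + z.2)

/-- The unit vector `ω ^ j`. -/
def unit (j : ZMod 6) : ℤ × ℤ := rot^[j.val] (1, 0)

/-- The determinant of two vectors in the basis `1, ω`; it is positive if and only if the second
vector lies to the left of the first. -/
def det (z w : ℤ × ℤ) : ℤ := z.1 * w.2 - z.2 * w.1

/-- An Eisenstein integer as a point of the plane. -/
def toPlane (z : ℤ × ℤ) : ℝ × ℝ := ((z.1 : ℝ), (z.2 : ℝ))

/-- The nonnegative integers `a`, `b` are Coxeter coordinates of the lattice vector `z`: up to a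
rotation by a multiple of `60°`, the vector is `a + b ω` (`a` steps straight on, a turn to the left
by `60°`, then `b` steps). -/
def IsCoxeter (z : ℤ × ℤ) (a b : ℕ) : Prop := ∃ k : ℕ, z = rot^[k] ((a : ℤ), (b : ℤ))

/-- An oriented edge of the triangular lattice: its initial point and the exponent `j` of its
direction `ω ^ j`. -/
abbrev LatticeDart : Type := (ℤ × ℤ) × ZMod 6

/-- The reversed edge. -/
def flip (d : LatticeDart) : LatticeDart := (d.1 + unit d.2, d.2 + 3)

/-- The next edge, counterclockwise, of the unit triangle on the left. -/
def next (d : LatticeDart) : LatticeDart := (d.1 + unit d.2, d.2 + 2)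

/-- The coordinates of the points of a unit triangle relative to one of its oriented edges. -/
def simplex : Set (ℝ × ℝ) := {q | 0 ≤ q.1 ∧ 0 ≤ q.2 ∧ q.1 + q.2 ≤ 1}

/-- The point `z + s ω ^ j + t ω ^ (j + 1)` with coordinates `(s, t)` relative to the oriented edge
`(z, j)`. -/
def point (d : LatticeDart) (q : ℝ × ℝ) : ℝ × ℝ :=
  toPlane d.1 + q.1 • toPlane (unit d.2) + q.2 • toPlane (unit (d.2 + 1))

/-- The closed unit triangle on the left of an oriented edge. -/
def triangle (d : LatticeDart) : Set (ℝ × ℝ) := point d '' simplex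

/-- The closed segment of an edge. -/
def segment (d : LatticeDart) : Set (ℝ × ℝ) := point d '' {q | q ∈ simplex ∧ q.2 = 0}

end Eisenstein

open Eisenstein in
/-- `u` unfolds the triangulated surface dual to `F` onto the Eisenstein plane along the region `R`:
it assigns to the oriented edges of all unit triangles that meet `R` oriented edges of the surface,
compatibly with the triangles that meet `R` and with the passage across the edges that meet `R`.
(The values of `u` on other edges do not matter.)  So every lattice point in `R` corresponds to
a hexagon. -/
structure IsUnfolding (F : CubicMap) (R : Set (ℝ × ℝ)) (u : LatticeDart → F.Dart) : Prop where
  map_next : ∀ d, (triangle d ∩ R).Nonempty → u (next d) = F.vert (u d)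
  map_flip : ∀ d, (segment d ∩ R).Nonempty → u (flip d) = F.flip (u d)

/-- A facet of the surface of `F`, unfolded onto the Eisenstein plane: a strictly convex polygon,
listed counterclockwise, whose corners are (centres of) pentagons, and which contains no other
pentagon. -/
structure UnfoldedFacet (F : CubicMap) where
  /-- The number of corners, less three. -/
  extra : ℕ
  corner : Fin (extra + 3) → ℤ × ℤ
  convex : ∀ i j, j ≠ i → j ≠ i + 1 →
    0 < Eisenstein.det (corner (i + 1) - corner i) (corner j - corner i)
  unfold : Eisenstein.LatticeDart → F.Dart
  isUnfolding : IsUnfolding F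
    (convexHull ℝ (Set.range fun i => Eisenstein.toPlane (corner i)) \
      Set.range fun i => Eisenstein.toPlane (corner i)) unfold
  pentagon : ∀ i j,
    (Eisenstein.triangle (corner i, j) ∩
      (convexHull ℝ (Set.range fun i => Eisenstein.toPlane (corner i)) \
        Set.range fun i => Eisenstein.toPlane (corner i))).Nonempty →
    F.faceSize (unfold (corner i, j)) = 5

namespace UnfoldedFacet

/-- The closed polygon. -/
def hull {F : CubicMap} (f : UnfoldedFacet F) : Set (ℝ × ℝ) :=
  convexHull ℝ (Set.range fun i => Eisenstein.toPlane (f.corner i))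

/-- The closed polygon without its corners. -/
def region {F : CubicMap} (f : UnfoldedFacet F) : Set (ℝ × ℝ) :=
  f.hull \ Set.range fun i => Eisenstein.toPlane (f.corner i)

/-- The point `p` of the facet (not a corner) represents the point of the surface that has the
coordinates `q` in the triangle on the left of `δ`. -/
def Represents {F : CubicMap} (f : UnfoldedFacet F) (p : ℝ × ℝ) (δ : F.Dart) (q : ℝ × ℝ) : Prop :=
  p ∈ f.region ∧ q ∈ Eisenstein.simplex ∧ ∃ d, f.unfold d = δ ∧ Eisenstein.point d q = p

/-- The vector of the `i`-th side of the facet, a master edge. -/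
def side {F : CubicMap} (f : UnfoldedFacet F) (i : Fin (f.extra + 3)) : ℤ × ℤ :=
  f.corner (i + 1) - f.corner i

end UnfoldedFacet

/-- A master polyhedron of `F`: a decomposition of the surface of `F` into flat convex polygons (for
instance triangles) whose corners are the pentagons.  The facets cover the surface (vertices of the
triangulation need not be mentioned here, by closedness), and a point inside a facet lies on no
other facet and only once on this one.  The facets then meet along whole sides, since a side is
a straight segment that runs from a pentagon to the next one. -/
structure MasterPolyhedron (F : CubicMap) where
  Facet : Type
  finite : Finite Facet
  facet : Facet → UnfoldedFacet F
  cover : ∀ (δ : F.Dart), ∀ q ∈ Eisenstein.simplex, q ≠ (0, 0) → q ≠ (1, 0) → q ≠ (0, 1) →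
    ∃ f p, (facet f).Represents p δ q
  disjoint : ∀ f g p p' δ q, p ∈ interior (facet f).hull →
    (facet f).Represents p δ q → (facet g).Represents p' δ q → f = g ∧ p = p'

/-!
The proof replaces both sides of the equivalence by the existence of a marking of vertices of the
dual triangulation, one in every triangle (`CubicMap.IsColoring`).

In a leapfrog fullerene the old vertices form such a marking.  Conversely, around a vertex without
mark the triangles are marked alternately on the next and on the previous neighbour, so all vertices
of odd degree, the pentagons, are marked, and the unmarked vertices are hexagons.  Hence the marked
vertices are the vertices of a smaller fullerene, whose triangles are spanned by the three marked
neighbours of each unmarked vertex, and the given fullerene is its leapfrog map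
(`CubicMap.isLeapfrog_iff_exists_isColoring`).

In the Eisenstein plane the only markings are the residue classes modulo `1 + ω`, because the mark of
a triangle determines the marks of the adjacent triangles.  As `ω ≡ -1`, a vector with the Coxeter
coordinates `a`, `b` has the residue `±(a - b)` modulo `1 + ω`, and the theorem says that there is
a marking if and only if all master edges have residue `0`.

If there is a marking, follow it along a master edge: it agrees with a residue class of the unfolded
facet, and both ends, being pentagons, lie in this class (`UnfoldedFacet.residue_side_eq_zero`).

If all master edges have residue `0`, then every facet has the marking by the residue class that
contains all its corners, and these markings have to agree where facets meet.  Suppose that two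
facets share a proper segment.  If a point inside the segment is interior to one of the facets, then
the facets coincide.  Otherwise the segment lies on the boundary of both, a supporting line shows that
the ray along it meets a corner of each, and the first of these corners is common to both, since
it is a pentagon and a lattice point of a facet that is not a corner is a hexagon.  Unfolded
from the common segment, the two facets agree along the ray, and both mark this corner, so their
markings agree (`UnfoldedFacet.color_eq_of_isLeast`).  Within one triangle of the surface, only
finitely many points are isolated common points of two facets, and the triangle without these points
is connected, so all facets give it the same mark (`MasterPolyhedron.exists_color`).
-/

namespace CubicMap

/-! ### Counting the cycles of a permutation -/

/-- Every point `x` contributes `1 / k` to the number of cycles, where `k` is the length of the cycle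
of `x`. -/
theorem cycleCount_eq_sum {α : Type} [Fintype α] (σ : Equiv.Perm α) :
    (cycleCount σ : ℚ) = ∑ x, (1 : ℚ) / Function.minimalPeriod σ x := by
  classical
  have hper : ∀ x, x ∈ Function.periodicPts σ := fun x =>
    (Equiv.injective σ).mem_periodicPts x
  have hpos : ∀ x, 0 < Function.minimalPeriod σ x := fun x =>
    Function.minimalPeriod_pos_of_mem_periodicPts (hper x)
  let s := Equiv.Perm.SameCycle.setoid σ
  have : Fintype (Quotient s) := Fintype.ofFinite _
  rw [cycleCount, show Nat.card (Quotient (Equiv.Perm.SameCycle.setoid σ)) =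
    Fintype.card (Quotient s) from Nat.card_eq_fintype_card,
    ← Finset.sum_fiberwise (s := Finset.univ) (g := fun x : α => (Quotient.mk s x))]
  have hfib : ∀ c : Quotient s,
      ∑ x with Quotient.mk s x = c, (1 : ℚ) / Function.minimalPeriod σ x = 1 := by
    intro c
    induction c using Quotient.inductionOn with
    | h y =>
    have himg : ({x | Quotient.mk s x = Quotient.mk s y} : Finset α) =
        (Finset.range (Function.minimalPeriod σ y)).image fun n => σ^[n] y := by
      ext x
      simp only [Finset.mem_filter, Finset.mem_univ, true_and, Finset.mem_image, Finset.mem_range]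
      constructor
      · intro h
        have h1 : σ.SameCycle y x := Quotient.exact h.symm
        have : Finite α := inferInstance
        obtain ⟨n, hn⟩ := h1.exists_nat_pow_eq
        refine ⟨n % Function.minimalPeriod σ y, Nat.mod_lt _ (hpos y), ?_⟩
        rw [Function.iterate_mod_minimalPeriod_eq, ← hn, Equiv.Perm.iterate_eq_pow]
      · rintro ⟨n, -, rfl⟩
        refine Quotient.sound (s := s) (Equiv.Perm.SameCycle.symm ⟨n, ?_⟩)
        rw [zpow_natCast, Equiv.Perm.iterate_eq_pow]
    have hconst : ∀ x ∈ ({x | Quotient.mk s x = Quotient.mk s y} : Finset α),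
        (1 : ℚ) / Function.minimalPeriod σ x = 1 / Function.minimalPeriod σ y := by
      intro x hx
      rw [himg] at hx
      obtain ⟨n, -, rfl⟩ := Finset.mem_image.1 hx
      rw [Function.minimalPeriod_apply_iterate (hper y)]
    rw [Finset.sum_congr rfl hconst, Finset.sum_const, himg, Finset.card_image_of_injOn,
      Finset.card_range, nsmul_eq_mul]
    · have := (hpos y).ne'
      field_simp
    · intro m hm n hn h
      exact Function.iterate_injOn_Iio_minimalPeriod (by simpa using hm) (by simpa using hn) h
  rw [Finset.sum_congr rfl fun c _ => hfib c]
  simp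

theorem minimalPeriod_eq_two {α : Type} {σ : Equiv.Perm α} {x : α} (h : σ (σ x) = x)
    (hne : σ x ≠ x) : Function.minimalPeriod σ x = 2 :=
  Function.minimalPeriod_eq_prime (p := 2) h hne

theorem minimalPeriod_eq_three {α : Type} {σ : Equiv.Perm α} {x : α} (h : σ (σ (σ x)) = x)
    (hne : σ x ≠ x) : Function.minimalPeriod σ x = 3 :=
  Function.minimalPeriod_eq_prime (p := 3) h hne

theorem perm_inv_apply_self {α : Type} (σ : Equiv.Perm α) (x : α) : σ⁻¹ (σ x) = x :=
  σ.symm_apply_apply x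

theorem perm_apply_inv_self {α : Type} (σ : Equiv.Perm α) (x : α) : σ (σ⁻¹ x) = x :=
  σ.apply_symm_apply x

/-! ### Leapfrog fullerenes and three-colourings -/

/-- A colouring that marks one corner of every triangle of the dual triangulation: the marked corner
of the triangle on the left of a dart is the initial vertex of the dart if the value is `0`, the
opposite vertex if it is `1`, and the final vertex if it is `2`.  The two equations say that the mark
belongs to the triangle, and that two adjacent triangles either have the same marked vertex on
their common edge or are both marked opposite to this edge. -/
structure IsColoring (F : CubicMap) (i : F.Dart → ZMod 3) : Prop where
  vert : ∀ d, i (F.vert d) = i d + 1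
  flip : ∀ d, i (F.flip d) = 2 - i d

variable {F : CubicMap}

theorem ring_apply (d : F.Dart) : F.ring d = F.flip (F.vert⁻¹ d) := rfl

theorem vert_inv (d : F.Dart) : F.vert⁻¹ d = F.vert (F.vert d) := by
  rw [Equiv.Perm.inv_eq_iff_eq, F.vert_vert_vert]

theorem ring_inv_apply (d : F.Dart) : F.ring⁻¹ d = F.vert (F.flip d) := by
  rw [Equiv.Perm.inv_eq_iff_eq, ring_apply, perm_inv_apply_self, F.flip_flip]

theorem iterate_ring_faceSize (d : F.Dart) : F.ring^[F.faceSize d] d = d :=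
  Function.iterate_minimalPeriod

namespace IsColoring

variable {i : F.Dart → ZMod 3}

theorem vert_inv (h : IsColoring F i) (d : F.Dart) : i (F.vert⁻¹ d) = i d - 1 := by
  have := h.vert (F.vert⁻¹ d)
  rw [perm_apply_inv_self] at this
  rw [this]; ring

theorem ring (h : IsColoring F i) (d : F.Dart) : i (F.ring d) = -i d := by
  rw [ring_apply, h.flip, h.vert_inv]
  generalize i d = t
  revert t; decide

theorem ring_inv (h : IsColoring F i) (d : F.Dart) : i (F.ring⁻¹ d) = -i d := by
  rw [ring_inv_apply, h.vert, h.flip]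
  generalize i d = t
  revert t; decide

/-- The sign changes around a vertex that is not marked, so its degree is even. -/
theorem eq_zero_of_faceSize (h : IsColoring F i) {d : F.Dart} (hd : F.faceSize d = 5) :
    i d = 0 := by
  have h5 := iterate_ring_faceSize d
  rw [hd] at h5
  have h6 := congrArg i h5
  simp only [Function.iterate_succ, Function.iterate_zero, Function.comp_apply, id_eq, h.ring,
    neg_neg] at h6
  generalize i d = t at *
  revert t; decide

/-- The colouring of a leapfrog map in which the old vertices are marked. -/
theorem leapfrog (G : CubicMap) : IsColoring G.leapfrog (fun x => (x.2 : Fin 3)) where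
  vert _ := rfl
  flip := by
    rintro ⟨d, k⟩
    fin_cases k <;> rfl

theorem of_iso {G : CubicMap} (e : Iso F G) {j : G.Dart → ZMod 3} (h : IsColoring G j) :
    IsColoring F (fun d => j (e.toEquiv d)) where
  vert d := by rw [e.map_vert, h.vert]
  flip d := by rw [e.map_flip, h.flip]

end IsColoring

theorem ring_ring_ne (d : F.Dart) (hd : F.faceSize d = 6) : F.ring (F.ring d) ≠ d := by
  intro h
  have : F.faceSize d ≤ 2 := Function.IsPeriodicPt.minimalPeriod_le (by norm_num) h
  omega

theorem iterate_ring_six (d : F.Dart) (hd : F.faceSize d = 6) :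
    F.ring (F.ring (F.ring (F.ring (F.ring (F.ring d))))) = d := by
  have := iterate_ring_faceSize d
  rwa [hd] at this

theorem IsColoring.faceSize_eq_six (hF : F.IsFullerene) {i : F.Dart → ZMod 3}
    (h : IsColoring F i) {d : F.Dart} (hd : i d ≠ 0) : F.faceSize d = 6 :=
  (hF.faces d).resolve_left fun h5 => hd (h.eq_zero_of_faceSize h5)

/-- The cubic map of which a coloured fullerene is the leapfrog map.  In the dual triangulation its
vertices are the marked vertices, and its triangles surround the vertices that are not marked.  Its
darts join the two marked vertices on both sides of an edge without marked ends; such a dart is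
represented by the old dart from its initial vertex to the unmarked vertex on its right. -/
def unleapfrog (hF : F.IsFullerene) {i : F.Dart → ZMod 3} (h : IsColoring F i) : CubicMap where
  Dart := {d // i d = 0}
  finite := by
    have := F.finite
    infer_instance
  flip :=
    { toFun := fun d => ⟨F.vert⁻¹ (F.flip (F.vert d)), by
        rw [h.vert_inv, h.flip, h.vert, d.2]; decide⟩
      invFun := fun d => ⟨F.vert⁻¹ (F.flip (F.vert d)), by
        rw [h.vert_inv, h.flip, h.vert, d.2]; decide⟩
      left_inv := fun d => by ext; simp [F.flip_flip]
      right_inv := fun d => by ext; simp [F.flip_flip] }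
  vert :=
    { toFun := fun d => ⟨F.vert (F.ring (F.ring (F.vert⁻¹ d))), by
        rw [h.vert, h.ring, h.ring, h.vert_inv, d.2]; decide⟩
      invFun := fun d => ⟨F.vert (F.ring⁻¹ (F.ring⁻¹ (F.vert⁻¹ d))), by
        rw [h.vert, h.ring_inv, h.ring_inv, h.vert_inv, d.2]; decide⟩
      left_inv := fun d => by ext; simp
      right_inv := fun d => by ext; simp }
  flip_flip d := by ext; simp [F.flip_flip]
  flip_ne d hd := by
    have := congrArg Subtype.val hd
    exact F.flip_ne (F.vert d) (Equiv.Perm.inv_eq_iff_eq.1 this)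
  vert_vert_vert d := by
    ext
    have hne : i (F.vert⁻¹ d.1) ≠ 0 := by rw [h.vert_inv, d.2]; decide
    simp only [Equiv.coe_fn_mk]
    rw [perm_inv_apply_self, perm_inv_apply_self]
    rw [iterate_ring_six _ (h.faceSize_eq_six hF hne), perm_apply_inv_self]
  vert_ne d hd := by
    have hne : i (F.vert⁻¹ d.1) ≠ 0 := by rw [h.vert_inv, d.2]; decide
    have := congrArg Subtype.val hd
    refine ring_ring_ne _ (h.faceSize_eq_six hF hne) ?_
    rw [Equiv.Perm.eq_inv_iff_eq]
    exact this

section Unleapfrog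

variable (hF : F.IsFullerene) {i : F.Dart → ZMod 3} (h : IsColoring F i)

theorem unleapfrog_flip_val (d : (unleapfrog hF h).Dart) :
    ((unleapfrog hF h).flip d).1 = F.vert⁻¹ (F.flip (F.vert d.1)) := rfl

theorem unleapfrog_ring_val (d : (unleapfrog hF h).Dart) :
    ((unleapfrog hF h).ring d).1 = F.ring d.1 := by
  have : ((unleapfrog hF h).vert⁻¹ d).1 = F.vert (F.ring⁻¹ (F.ring⁻¹ (F.vert⁻¹ d.1))) := rfl
  rw [CubicMap.ring_apply, unleapfrog_flip_val, this]
  simp only [ring_inv_apply, CubicMap.vert_inv, F.vert_vert_vert, F.flip_flip, ring_apply]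

theorem unleapfrog_ring_inv_val (d : (unleapfrog hF h).Dart) :
    ((unleapfrog hF h).ring⁻¹ d).1 = F.ring⁻¹ d.1 := by
  rw [Equiv.Perm.eq_inv_iff_eq, ← unleapfrog_ring_val hF h, perm_apply_inv_self]

theorem unleapfrog_faceSize (d : (unleapfrog hF h).Dart) :
    (unleapfrog hF h).faceSize d = F.faceSize d.1 := by
  have hiter : ∀ n, ((unleapfrog hF h).ring^[n] d).1 = F.ring^[n] d.1 := by
    intro n
    induction n with
    | zero => rfl
    | succ n ih => rw [Function.iterate_succ_apply', Function.iterate_succ_apply',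
        unleapfrog_ring_val, ih]
  refine Nat.dvd_antisymm (Function.IsPeriodicPt.minimalPeriod_dvd ?_)
    (Function.IsPeriodicPt.minimalPeriod_dvd ?_)
  · exact Subtype.ext ((hiter _).trans (iterate_ring_faceSize d.1))
  · exact (hiter _).symm.trans (congrArg Subtype.val (iterate_ring_faceSize d))

/-- Every triangle of a coloured map has exactly one dart that starts at the marked corner; the second
component counts the turns from there. -/
def unleapfrogEquiv : (unleapfrog hF h).leapfrog.Dart ≃ F.Dart where
  toFun x := F.vert^[(x.2 : Fin 3).val] x.1.1
  invFun d := (⟨F.vert^[3 - (i d).val] d, by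
    have hn : ∀ n, i (F.vert^[n] d) = i d + n := by
      intro n
      induction n with
      | zero => simp
      | succ n ih => rw [Function.iterate_succ_apply', h.vert, ih]; push_cast; ring
    rw [hn]
    generalize i d = t
    revert t; decide⟩, i d)
  left_inv := by
    rintro ⟨⟨d, hd⟩, k⟩
    fin_cases k
    · refine Prod.ext (Subtype.ext ?_) hd
      simp [hd, F.vert_vert_vert]
    · have h1 : i (F.vert d) = 1 := by rw [h.vert, hd]; decide
      refine Prod.ext (Subtype.ext ?_) h1
      have : 3 - (1 : ZMod 3).val = 2 := rfl
      simp [h1, this, F.vert_vert_vert]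
    · have h2 : i (F.vert (F.vert d)) = 2 := by rw [h.vert, h.vert, hd]; decide
      refine Prod.ext (Subtype.ext ?_) h2
      have : 3 - (2 : ZMod 3).val = 1 := rfl
      simp [h2, this, F.vert_vert_vert]
  right_inv := by
    intro d
    change F.vert^[(i d).val] (F.vert^[3 - (i d).val] d) = d
    rw [← Function.iterate_add_apply]
    have : (i d).val < 3 := ZMod.val_lt _
    rw [Nat.add_sub_cancel' this.le]
    exact F.vert_vert_vert d

theorem unleapfrogEquiv_vert (x : (unleapfrog hF h).leapfrog.Dart) :
    unleapfrogEquiv hF h ((unleapfrog hF h).leapfrog.vert x) =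
      F.vert (unleapfrogEquiv hF h x) := by
  obtain ⟨d, k⟩ := x
  fin_cases k
  · rfl
  · rfl
  · exact (F.vert_vert_vert d.1).symm

theorem unleapfrogEquiv_flip (x : (unleapfrog hF h).leapfrog.Dart) :
    unleapfrogEquiv hF h ((unleapfrog hF h).leapfrog.flip x) =
      F.flip (unleapfrogEquiv hF h x) := by
  obtain ⟨d, k⟩ := x
  fin_cases k
  · change F.vert (F.vert ((unleapfrog hF h).ring⁻¹ d).1) = F.flip d.1
    rw [unleapfrog_ring_inv_val, ring_inv_apply, F.vert_vert_vert]
  · change F.vert ((unleapfrog hF h).flip d).1 = F.flip (F.vert d.1)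
    rw [unleapfrog_flip_val, perm_apply_inv_self]
  · change ((unleapfrog hF h).ring d).1 = F.flip (F.vert (F.vert d.1))
    rw [unleapfrog_ring_val, ring_apply, CubicMap.vert_inv]

/-- A coloured fullerene is the leapfrog map of the map of its marked vertices. -/
def unleapfrogIso : Iso F (unleapfrog hF h).leapfrog where
  toEquiv := (unleapfrogEquiv hF h).symm
  map_flip d := by
    rw [Equiv.symm_apply_eq, unleapfrogEquiv_flip, Equiv.apply_symm_apply]
  map_vert d := by
    rw [Equiv.symm_apply_eq, unleapfrogEquiv_vert, Equiv.apply_symm_apply]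

theorem unleapfrog_connected (d d' : (unleapfrog hF h).Dart) :
    ∃ g ∈ Subgroup.closure {(unleapfrog hF h).flip, (unleapfrog hF h).vert}, g d = d' := by
  let G := unleapfrog hF h
  let H := Subgroup.closure {G.flip, G.vert}
  have hflip : G.flip ∈ H := Subgroup.subset_closure (by simp)
  have hvert : G.vert ∈ H := Subgroup.subset_closure (by simp)
  have hring : G.ring ∈ H := H.mul_mem hflip (H.inv_mem hvert)
  let p : F.Dart → G.Dart := fun d => ((unleapfrogIso hF h).toEquiv d).1
  have hp : ∀ d : G.Dart, p d.1 = d := fun d =>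
    congrArg Prod.fst ((unleapfrogEquiv hF h).symm_apply_apply (d, (0 : Fin 3)))
  have key : ∀ g ∈ Subgroup.closure {F.flip, F.vert}, ∀ d, ∃ g' ∈ H, g' (p d) = p (g d) := by
    intro g hg
    induction hg using Subgroup.closure_induction with
    | mem g hg =>
      intro d
      rcases hg with rfl | rfl
      · simp only [p, (unleapfrogIso hF h).map_flip]
        generalize (unleapfrogIso hF h).toEquiv d = x
        obtain ⟨x, k⟩ := x
        fin_cases k
        · exact ⟨_, H.inv_mem hring, rfl⟩
        · exact ⟨_, hflip, rfl⟩
        · exact ⟨_, hring, rfl⟩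
      · exact ⟨1, H.one_mem, by simp only [p, (unleapfrogIso hF h).map_vert]; rfl⟩
    | one => exact fun d => ⟨1, H.one_mem, rfl⟩
    | mul g₁ g₂ _ _ ih₁ ih₂ =>
      intro d
      obtain ⟨g, hg, e⟩ := ih₂ d
      obtain ⟨g', hg', e'⟩ := ih₁ (g₂ d)
      exact ⟨g' * g, H.mul_mem hg' hg, by rw [Equiv.Perm.mul_apply, e, e']; rfl⟩
    | inv g _ ih =>
      intro d
      obtain ⟨g', hg', e⟩ := ih (g⁻¹ d)
      refine ⟨g'⁻¹, H.inv_mem hg', ?_⟩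
      rw [Equiv.Perm.inv_eq_iff_eq, e, perm_apply_inv_self]
  obtain ⟨g, hg, e⟩ := hF.connected d.1 d'.1
  obtain ⟨g', hg', e'⟩ := key g hg d.1
  refine ⟨g', hg', ?_⟩
  rw [e, hp, hp] at e'
  exact e'

theorem unleapfrog_euler :
    cycleCount (unleapfrog hF h).vert + cycleCount (unleapfrog hF h).ring =
      cycleCount (unleapfrog hF h).flip + 2 := by
  set G := unleapfrog hF h with hG
  have := F.finite
  have := G.finite
  have : Fintype F.Dart := Fintype.ofFinite _
  have : Fintype G.Dart := Fintype.ofFinite _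
  have hsum : ∀ w : F.Dart → ℚ,
      ∑ d, w d = ∑ g : G.Dart, (w g.1 + w (F.vert g.1) + w (F.vert (F.vert g.1))) := by
    intro w
    let e : G.Dart × Fin 3 ≃ F.Dart := unleapfrogEquiv hF h
    have : ∑ d, w d = ∑ x : G.Dart × Fin 3, w (e x) := (Equiv.sum_comp e w).symm
    rw [this, Fintype.sum_prod_type]
    refine Finset.sum_congr rfl fun g _ => ?_
    rw [Fin.sum_univ_three]
    rfl
  have e := congrArg (Nat.cast (R := ℚ)) hF.euler
  apply Nat.cast_injective (R := ℚ)
  push_cast at e ⊢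
  have hv : ∀ d : F.Dart, (1 : ℚ) / Function.minimalPeriod F.vert d = 1 / 3 := fun d => by
    rw [minimalPeriod_eq_three (F.vert_vert_vert d) (F.vert_ne d)]; norm_num
  have hf : ∀ d : F.Dart, (1 : ℚ) / Function.minimalPeriod F.flip d = 1 / 2 := fun d => by
    rw [minimalPeriod_eq_two (F.flip_flip d) (F.flip_ne d)]; norm_num
  have hv' : ∀ d : G.Dart, (1 : ℚ) / Function.minimalPeriod G.vert d = 1 / 3 := fun d => by
    rw [minimalPeriod_eq_three (G.vert_vert_vert d) (G.vert_ne d)]; norm_num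
  have hf' : ∀ d : G.Dart, (1 : ℚ) / Function.minimalPeriod G.flip d = 1 / 2 := fun d => by
    rw [minimalPeriod_eq_two (G.flip_flip d) (G.flip_ne d)]; norm_num
  have hr : ∀ d : F.Dart, i d ≠ 0 → (1 : ℚ) / Function.minimalPeriod F.ring d = 1 / 6 :=
    fun d hd => by
      rw [show Function.minimalPeriod F.ring d = 6 from h.faceSize_eq_six hF hd]; norm_num
  have hr' : ∀ d : G.Dart, (1 : ℚ) / Function.minimalPeriod G.ring d =
      1 / Function.minimalPeriod F.ring d.1 := fun d => by
    rw [show Function.minimalPeriod G.ring d = Function.minimalPeriod F.ring d.1 from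
      unleapfrog_faceSize hF h d]
  have hr1 : ∀ g : G.Dart, (1 : ℚ) / Function.minimalPeriod F.ring (F.vert g.1) = 1 / 6 :=
    fun g => hr _ (by rw [h.vert, g.2]; decide)
  have hr2 : ∀ g : G.Dart, (1 : ℚ) / Function.minimalPeriod F.ring (F.vert (F.vert g.1)) = 1 / 6 :=
    fun g => hr _ (by rw [h.vert, h.vert, g.2]; decide)
  simp only [cycleCount_eq_sum, hsum, hv, hf, hv', hf', hr', hr1, hr2, Finset.sum_add_distrib,
    Finset.sum_const, nsmul_eq_mul] at e ⊢
  linarith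

theorem unleapfrog_isFullerene : (unleapfrog hF h).IsFullerene where
  nonempty := by
    obtain ⟨d⟩ := hF.nonempty
    exact ⟨((unleapfrogIso hF h).toEquiv d).1⟩
  connected := unleapfrog_connected hF h
  euler := unleapfrog_euler hF h
  faces d := by
    rw [unleapfrog_faceSize]
    exact hF.faces d.1

end Unleapfrog

theorem isLeapfrog_iff_exists_isColoring (hF : F.IsFullerene) :
    F.IsLeapfrog ↔ ∃ i, IsColoring F i := by
  constructor
  · rintro ⟨G, -, ⟨e⟩⟩
    exact ⟨_, (IsColoring.leapfrog G).of_iso e⟩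
  · rintro ⟨i, h⟩
    exact ⟨_, unleapfrog_isFullerene hF h, ⟨unleapfrogIso hF h⟩⟩

end CubicMap

namespace Eisenstein

/-! ### The triangular lattice -/

theorem unit_add (k l : ZMod 6) :
    unit (k + l) = (unit l).1 • unit k + (unit l).2 • unit (k + 1) := by
  revert k l; decide

theorem unit_add_two (k : ZMod 6) : unit (k + 2) = unit (k + 1) - unit k := by
  revert k; decide

theorem unit_add_three (k : ZMod 6) : unit (k + 3) = -unit k := by
  revert k; decide

theorem unit_det (k : ZMod 6) :
    (unit k).1 * (unit (k + 1)).2 - (unit k).2 * (unit (k + 1)).1 = 1 := by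
  revert k; decide

theorem toPlane_add (z w : ℤ × ℤ) : toPlane (z + w) = toPlane z + toPlane w := by
  simp [toPlane]

theorem toPlane_sub (z w : ℤ × ℤ) : toPlane (z - w) = toPlane z - toPlane w := by
  simp [toPlane]

theorem toPlane_neg (z : ℤ × ℤ) : toPlane (-z) = -toPlane z := by
  simp [toPlane]

theorem toPlane_zsmul (n : ℤ) (z : ℤ × ℤ) : toPlane (n • z) = (n : ℝ) • toPlane z := by
  simp [toPlane]

theorem toPlane_injective : Function.Injective toPlane := by
  intro z w h
  simp only [toPlane, Prod.mk.injEq, Int.cast_inj] at h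
  exact Prod.ext h.1 h.2

/-- The lattice point with the coordinates `w` relative to the oriented edge `d`. -/
def latticePoint (d : LatticeDart) (w : ℤ × ℤ) : ℤ × ℤ :=
  d.1 + w.1 • unit d.2 + w.2 • unit (d.2 + 1)

/-- The orientation-preserving automorphism of the triangular lattice that takes the edge from `0` to
`1` to `d`, on oriented edges. -/
def place (d e : LatticeDart) : LatticeDart := (latticePoint d e.1, d.2 + e.2)

theorem toPlane_latticePoint (d : LatticeDart) (w : ℤ × ℤ) :
    toPlane (latticePoint d w) = point d (toPlane w) := by
  simp only [latticePoint, point, toPlane_add, toPlane_zsmul]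
  rfl

theorem latticePoint_add (d : LatticeDart) (w v : ℤ × ℤ) :
    latticePoint d (w + v) = latticePoint d w + v.1 • unit d.2 + v.2 • unit (d.2 + 1) := by
  simp only [latticePoint, Prod.fst_add, Prod.snd_add, add_smul]
  abel

theorem latticePoint_add_unit (d : LatticeDart) (w : ℤ × ℤ) (k : ZMod 6) :
    latticePoint d (w + unit k) = latticePoint d w + unit (d.2 + k) := by
  rw [latticePoint_add, unit_add d.2 k, add_assoc]

theorem exists_latticePoint_eq (d : LatticeDart) (z : ℤ × ℤ) : ∃ w, latticePoint d w = z := by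
  have h := unit_det d.2
  refine ⟨((z.1 - d.1.1) * (unit (d.2 + 1)).2 - (z.2 - d.1.2) * (unit (d.2 + 1)).1,
    (unit d.2).1 * (z.2 - d.1.2) - (unit d.2).2 * (z.1 - d.1.1)), ?_⟩
  ext
  · simp only [latticePoint, Prod.fst_add, Prod.smul_fst, smul_eq_mul]
    linear_combination (z.1 - d.1.1) * h
  · simp only [latticePoint, Prod.snd_add, Prod.smul_snd, smul_eq_mul]
    linear_combination (z.2 - d.1.2) * h

theorem place_next (d e : LatticeDart) : place d (next e) = next (place d e) := by
  simp only [place, next, latticePoint_add_unit, add_assoc]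

theorem place_flip (d e : LatticeDart) : place d (flip e) = flip (place d e) := by
  simp only [place, flip, latticePoint_add_unit, add_assoc]

theorem place_origin (d : LatticeDart) : place d ((0, 0), 0) = d := by
  simp [place, latticePoint]

theorem point_origin (q : ℝ × ℝ) : point ((0, 0), 0) q = q := by
  have h0 : unit 0 = (1, 0) := by decide
  have h1 : unit 1 = (0, 1) := by decide
  simp [point, h0, h1, toPlane]

theorem point_add_smul (d : LatticeDart) (q v : ℝ × ℝ) (r : ℝ) :
    point d (q + r • v) =
      point d q + r • (v.1 • toPlane (unit d.2) + v.2 • toPlane (unit (d.2 + 1))) := by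
  simp only [point, Prod.fst_add, Prod.snd_add, Prod.smul_fst, Prod.smul_snd, smul_eq_mul]
  module

theorem point_place (d e : LatticeDart) (q : ℝ × ℝ) :
    point (place d e) q = point d (point e q) := by
  have h : ∀ k, toPlane (unit (d.2 + k)) = (toPlane (unit k)).1 • toPlane (unit d.2) +
      (toPlane (unit k)).2 • toPlane (unit (d.2 + 1)) := by
    intro k
    rw [unit_add, toPlane_add, toPlane_zsmul, toPlane_zsmul]
    rfl
  have h0 := h e.2
  have h1 := h (e.2 + 1)
  simp only [point, place, toPlane_latticePoint, add_assoc d.2, Prod.fst_add, Prod.snd_add,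
    Prod.smul_fst, Prod.smul_snd, smul_eq_mul]
  rw [h0, h1]
  module

theorem continuous_point (d : LatticeDart) : Continuous (point d) := by
  unfold point
  fun_prop

theorem triangle_place (d e : LatticeDart) : triangle (place d e) = point d '' triangle e := by
  simp only [triangle, Set.image_image, point_place]

theorem segment_place (d e : LatticeDart) : segment (place d e) = point d '' segment e := by
  simp only [segment, Set.image_image, point_place]

theorem triangle_origin : triangle ((0, 0), 0) = simplex := by
  simp only [triangle, point_origin, Set.image_id']

theorem point_injective (d : LatticeDart) : Function.Injective (point d) := by
  intro q q' h
  have hdet : ((unit d.2).1 : ℝ) * (unit (d.2 + 1)).2 - (unit d.2).2 * (unit (d.2 + 1)).1 = 1 :=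
    mod_cast unit_det d.2
  simp only [point, toPlane, Prod.ext_iff, Prod.fst_add, Prod.snd_add, Prod.smul_fst,
    Prod.smul_snd, smul_eq_mul] at h
  obtain ⟨h1, h2⟩ := h
  ext
  · linear_combination (unit (d.2 + 1)).2 * h1 - (unit (d.2 + 1)).1 * h2 - (q.1 - q'.1) * hdet
  · linear_combination (unit d.2).1 * h2 - (unit d.2).2 * h1 - (q.2 - q'.2) * hdet

/-- The coordinates of two distinct points determine an oriented edge. -/
theorem eq_of_point_eq {d d' : LatticeDart} {q q' : ℝ × ℝ} (hne : q ≠ q')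
    (h : point d q = point d' q) (h' : point d q' = point d' q') : d = d' := by
  obtain ⟨⟨a, b⟩, k⟩ := d
  obtain ⟨⟨a', b'⟩, k'⟩ := d'
  simp only [point, toPlane, Prod.ext_iff, Prod.fst_add, Prod.snd_add, Prod.smul_fst,
    Prod.smul_snd, smul_eq_mul] at h h'
  obtain ⟨h1, h2⟩ := h
  obtain ⟨h1', h2'⟩ := h'
  have hk : k = k' := by
    by_contra hk
    apply hne
    have e0 : unit 0 = (1, 0) := by decide
    have e1 : unit 1 = (0, 1) := by decide
    have e2 : unit 2 = (-1, 1) := by decide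
    have e3 : unit 3 = (-1, 0) := by decide
    have e4 : unit 4 = (0, -1) := by decide
    have e5 : unit 5 = (1, -1) := by decide
    have f1 : (0 : ZMod 6) + 1 = 1 := by decide
    have f2 : (1 : ZMod 6) + 1 = 2 := by decide
    have f3 : (2 : ZMod 6) + 1 = 3 := by decide
    have f4 : (3 : ZMod 6) + 1 = 4 := by decide
    have f5 : (4 : ZMod 6) + 1 = 5 := by decide
    have f6 : (5 : ZMod 6) + 1 = 0 := by decide
    have hz : ∀ j : ZMod 6, j = 0 ∨ j = 1 ∨ j = 2 ∨ j = 3 ∨ j = 4 ∨ j = 5 := by decide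
    rcases hz k with rfl | rfl | rfl | rfl | rfl | rfl <;>
    rcases hz k' with rfl | rfl | rfl | rfl | rfl | rfl <;>
    first
    | exact absurd rfl hk
    | (simp only [e0, e1, e2, e3, e4, e5, f1, f2, f3, f4, f5, f6, Int.cast_one, Int.cast_zero,
        Int.cast_neg] at h1 h2 h1' h2'
       ext <;> linarith)
  subst hk
  have ha : (a : ℝ) = a' := by linarith
  have hb : (b : ℝ) = b' := by linarith
  rw [Int.cast_inj.1 ha, Int.cast_inj.1 hb]

theorem next_next_next (d : LatticeDart) : next (next (next d)) = d := by
  have h : ∀ k : ZMod 6, unit k + unit (k + 2) + unit (k + 2 + 2) = 0 ∧ k + 2 + 2 + 2 = k := by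
    decide
  obtain ⟨z, k⟩ := d
  simp only [next, add_assoc z, (h k).1, (h k).2, add_zero]

theorem point_next (d : LatticeDart) (q : ℝ × ℝ) :
    point (next d) q = point d (1 - q.1 - q.2, q.1) := by
  have h : d.2 + 2 + 1 = d.2 + 3 := by ring
  simp only [point, next, h, unit_add_two, unit_add_three, toPlane_add, toPlane_sub, toPlane_neg]
  module

theorem point_flip (d : LatticeDart) (q : ℝ × ℝ) : point (flip d) q = point d (1 - q.1, -q.2) := by
  have h : d.2 + 3 + 1 = d.2 + 1 + 3 := by ring
  simp only [point, flip, h, unit_add_three, toPlane_add, toPlane_neg]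
  module

theorem triangle_next (d : LatticeDart) : triangle (next d) = triangle d := by
  have h : ∀ d, triangle (next d) ⊆ triangle d := by
    rintro d _ ⟨q, hq, rfl⟩
    refine ⟨_, ?_, (point_next d q).symm⟩
    obtain ⟨h1, h2, h3⟩ := hq
    exact ⟨by linarith, h1, by linarith⟩
  refine (h d).antisymm ?_
  conv_lhs => rw [← next_next_next d]
  exact (h _).trans (h _)

theorem segment_subset_triangle (d : LatticeDart) : segment d ⊆ triangle d :=
  Set.image_mono fun _ hq => hq.1

theorem isCompact_simplex : IsCompact simplex := by
  refine (isCompact_Icc (a := ((0, 0) : ℝ × ℝ)) (b := (1, 1))).of_isClosed_subset ?_ ?_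
  · exact (isClosed_le continuous_const continuous_fst).inter
      ((isClosed_le continuous_const continuous_snd).inter
        (isClosed_le (continuous_fst.add continuous_snd) continuous_const))
  · rintro q ⟨h1, h2, h3⟩
    exact ⟨⟨h1, h2⟩, ⟨by linarith, by linarith⟩⟩

theorem convex_simplex : Convex ℝ simplex := by
  rintro p ⟨h1, h2, h3⟩ q ⟨h4, h5, h6⟩ a b ha hb hab
  refine ⟨?_, ?_, ?_⟩
  · exact add_nonneg (mul_nonneg ha h1) (mul_nonneg hb h4)
  · exact add_nonneg (mul_nonneg ha h2) (mul_nonneg hb h5)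
  · have e : (a • p + b • q).1 + (a • p + b • q).2 = a * (p.1 + p.2) + b * (q.1 + q.2) := by
      simp only [Prod.fst_add, Prod.snd_add, Prod.smul_fst, Prod.smul_snd, smul_eq_mul]
      ring
    rw [e, ← hab]
    nlinarith

theorem isCompact_triangle (d : LatticeDart) : IsCompact (triangle d) :=
  isCompact_simplex.image (continuous_point d)

theorem isClosed_triangle (d : LatticeDart) : IsClosed (triangle d) :=
  (isCompact_triangle d).isClosed

theorem mem_triangle_up {z : ℤ × ℤ} {p : ℝ × ℝ} :
    p ∈ triangle (z, 0) ↔ (z.1 : ℝ) ≤ p.1 ∧ (z.2 : ℝ) ≤ p.2 ∧ p.1 + p.2 ≤ z.1 + z.2 + 1 := by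
  have e0 : unit 0 = (1, 0) := by decide
  have e1 : unit 1 = (0, 1) := by decide
  constructor
  · rintro ⟨q, ⟨h1, h2, h3⟩, rfl⟩
    simp only [point, toPlane, e0, zero_add, e1, Prod.fst_add, Prod.snd_add, Prod.smul_fst,
      Prod.smul_snd, smul_eq_mul, Int.cast_one, Int.cast_zero]
    refine ⟨?_, ?_, ?_⟩ <;> linarith
  · rintro ⟨h1, h2, h3⟩
    refine ⟨(p.1 - z.1, p.2 - z.2), ⟨?_, ?_, ?_⟩, ?_⟩
    · exact sub_nonneg.2 h1
    · exact sub_nonneg.2 h2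
    · simp only; linarith
    · ext <;> simp [point, toPlane, e0, e1]

theorem mem_triangle_down {z : ℤ × ℤ} {p : ℝ × ℝ} :
    p ∈ triangle (z, 1) ↔ p.1 ≤ z.1 ∧ p.2 ≤ z.2 + 1 ∧ (z.1 : ℝ) + z.2 ≤ p.1 + p.2 := by
  have e0 : unit 1 = (0, 1) := by decide
  have e1 : unit (1 + 1) = (-1, 1) := by decide
  constructor
  · rintro ⟨q, ⟨h1, h2, h3⟩, rfl⟩
    simp only [point, toPlane, e0, e1, Prod.fst_add, Prod.snd_add, Prod.smul_fst, Prod.smul_snd,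
      smul_eq_mul, Int.cast_one, Int.cast_zero, Int.cast_neg]
    refine ⟨?_, ?_, ?_⟩ <;> linarith
  · rintro ⟨h1, h2, h3⟩
    refine ⟨(p.1 + p.2 - z.1 - z.2, z.1 - p.1), ⟨?_, ?_, ?_⟩, ?_⟩
    · simp only; linarith
    · exact sub_nonneg.2 h1
    · simp only; linarith
    · ext
      · simp [point, toPlane, e0, e1]
      · simp [point, toPlane, e0, e1]

/-- Every triangle of the lattice is one of the two on both sides of an edge of direction `ω`. -/
theorem exists_iterate_next (d : LatticeDart) :
    ∃ z : ℤ × ℤ, ∃ k : ZMod 6, (k = 0 ∨ k = 1) ∧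
      (d = (z, k) ∨ next d = (z, k) ∨ next (next d) = (z, k)) := by
  have h : ∀ k : ZMod 6, k = 0 ∨ k = 1 ∨ k + 2 = 0 ∨ k + 2 = 1 ∨ k + 2 + 2 = 0 ∨ k + 2 + 2 = 1 := by
    decide
  rcases h d.2 with h | h | h | h | h | h
  · exact ⟨_, _, Or.inl h, Or.inl rfl⟩
  · exact ⟨_, _, Or.inr h, Or.inl rfl⟩
  · exact ⟨_, _, Or.inl h, Or.inr (Or.inl rfl)⟩
  · exact ⟨_, _, Or.inr h, Or.inr (Or.inl rfl)⟩
  · exact ⟨_, _, Or.inl h, Or.inr (Or.inr rfl)⟩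
  · exact ⟨_, _, Or.inr h, Or.inr (Or.inr rfl)⟩

theorem locallyFinite_triangle : LocallyFinite triangle := by
  intro p
  refine ⟨Metric.ball p 1, Metric.ball_mem_nhds p one_pos, ?_⟩
  have hfin : (Set.Icc ((⌊p.1⌋ - 3, ⌊p.2⌋ - 3) : ℤ × ℤ) (⌊p.1⌋ + 3, ⌊p.2⌋ + 3) ×ˢ
      (Set.univ : Set (ZMod 6))).Finite := (Set.finite_Icc _ _).prod Set.finite_univ
  refine hfin.subset ?_
  rintro ⟨z, k⟩ ⟨x, ⟨q, ⟨h1, h2, h3⟩, rfl⟩, hx⟩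
  refine ⟨?_, trivial⟩
  have hu : ∀ k, -1 ≤ (unit k).1 ∧ (unit k).1 ≤ 1 ∧ -1 ≤ (unit k).2 ∧ (unit k).2 ≤ 1 := by decide
  have hb : ∀ n : ℤ, -1 ≤ n → n ≤ 1 → ∀ t : ℝ, 0 ≤ t → -t ≤ t * n ∧ t * n ≤ t := by
    intro n hn hn' t ht
    have h1 : (-1 : ℝ) ≤ n := mod_cast hn
    have h2 : (n : ℝ) ≤ 1 := mod_cast hn'
    constructor <;> nlinarith
  rw [Metric.mem_ball, Prod.dist_eq, max_lt_iff, Real.dist_eq, Real.dist_eq, abs_lt, abs_lt] at hx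
  simp only [point, toPlane, Prod.fst_add, Prod.snd_add, Prod.smul_fst, Prod.smul_snd,
    smul_eq_mul] at hx
  obtain ⟨⟨a1, a2⟩, a3, a4⟩ := hx
  obtain ⟨u1, u2, u3, u4⟩ := hu k
  obtain ⟨v1, v2, v3, v4⟩ := hu (k + 1)
  have b1 := hb _ u1 u2 _ h1
  have b2 := hb _ u3 u4 _ h1
  have b3 := hb _ v1 v2 _ h2
  have b4 := hb _ v3 v4 _ h2
  have f1 := Int.floor_le p.1
  have f2 := Int.lt_floor_add_one p.1
  have f3 := Int.floor_le p.2
  have f4 := Int.lt_floor_add_one p.2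
  simp only [Set.mem_Icc, Prod.le_def]
  refine ⟨⟨?_, ?_⟩, ?_, ?_⟩
  · have : ((⌊p.1⌋ - 3 : ℤ) : ℝ) ≤ z.1 := by push_cast; linarith
    exact_mod_cast this
  · have : ((⌊p.2⌋ - 3 : ℤ) : ℝ) ≤ z.2 := by push_cast; linarith
    exact_mod_cast this
  · have : (z.1 : ℝ) ≤ (⌊p.1⌋ + 3 : ℤ) := by push_cast; linarith
    exact_mod_cast this
  · have : (z.2 : ℝ) ≤ (⌊p.2⌋ + 3 : ℤ) := by push_cast; linarith
    exact_mod_cast this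

/-! ### Propagation along connected sets -/

section Propagation

variable {S : Set (ℝ × ℝ)} {Q : LatticeDart → Prop}

/-- A property of oriented edges passes through triangles and across edges at points of `S`. -/
structure Propagates (S : Set (ℝ × ℝ)) (Q : LatticeDart → Prop) : Prop where
  iff_next : ∀ d, (triangle d ∩ S).Nonempty → (Q (next d) ↔ Q d)
  iff_flip : ∀ d, (segment d ∩ S).Nonempty → (Q (flip d) ↔ Q d)

theorem Propagates.mono {S' : Set (ℝ × ℝ)} (h : Propagates S Q) (hS : S' ⊆ S) :
    Propagates S' Q :=
  ⟨fun d hd => h.iff_next d (hd.mono (Set.inter_subset_inter_right _ hS)),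
    fun d hd => h.iff_flip d (hd.mono (Set.inter_subset_inter_right _ hS))⟩

/-- Any two triangles at a point of `S` are joined by a chain of triangles across edges at that
point: all of them are joined to the triangle that is found by rounding the coordinates down. -/
theorem Propagates.iff_of_mem (h : Propagates S Q) {p : ℝ × ℝ} (hp : p ∈ S) {d d' : LatticeDart}
    (hd : p ∈ triangle d) (hd' : p ∈ triangle d') : Q d ↔ Q d' := by
  have e0 : unit 0 = (1, 0) := by decide
  have e1 : unit 1 = (0, 1) := by decide
  have e2 : unit 2 = (-1, 1) := by decide
  have e3 : unit 3 = (-1, 0) := by decide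
  have e4 : unit 4 = (0, -1) := by decide
  have e5 : unit 5 = (1, -1) := by decide
  have hnext : ∀ d, p ∈ triangle d → (Q (next d) ↔ Q d) := fun d hd => h.iff_next d ⟨p, hd, hp⟩
  -- The three edges of an upward triangle.
  have hv : ∀ z : ℤ × ℤ, p ∈ triangle (z, 0) → p.1 = z.1 → (Q (z, 0) ↔ Q (z, 1)) := by
    intro z hz hx
    have hz' := mem_triangle_up.1 hz
    have e : next (next (z, 0)) = (z + (0, 1), 4) := by
      simp only [next, zero_add, e0, e2, show (2 : ZMod 6) + 2 = 4 by decide, add_assoc]; rfl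
    have ef : flip (z + (0, 1), 4) = (z, 1) := by
      simp only [flip, e4, add_assoc, show (4 : ZMod 6) + 3 = 1 by decide]; simp
    rw [← hnext _ hz, ← hnext _ (by rwa [triangle_next]), e, ← ef]
    refine (h.iff_flip _ ⟨p, ⟨(z.2 + 1 - p.2, 0), ⟨⟨?_, le_rfl, ?_⟩, rfl⟩, ?_⟩, hp⟩).symm
    · simp only; linarith
    · simp only; linarith
    · ext <;> simp [point, toPlane, e4, hx]
  have hh : ∀ z : ℤ × ℤ, p ∈ triangle (z, 0) → p.2 = z.2 → (Q (z, 0) ↔ Q (z + (1, -1), 1)) := by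
    intro z hz hx
    have hz' := mem_triangle_up.1 hz
    have ef : next (next (flip (z, 0))) = (z + (1, -1), 1) := by
      simp only [flip, next, e0, zero_add, e3, show (3 : ZMod 6) + 2 = 5 by decide, e5,
        show (5 : ZMod 6) + 2 = 1 by decide, add_assoc]; rfl
    have hs : p ∈ segment (z, 0) := by
      refine ⟨(p.1 - z.1, 0), ⟨⟨?_, le_rfl, ?_⟩, rfl⟩, ?_⟩
      · simp only; linarith
      · simp only; linarith
      · ext <;> simp [point, toPlane, e0, hx]
    have ht : p ∈ triangle (flip (z, 0)) := by
      rw [← triangle_next, ← triangle_next, ef, mem_triangle_down]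
      simp only [Prod.fst_add, Prod.snd_add]
      push_cast
      refine ⟨?_, ?_, ?_⟩ <;> linarith
    rw [← ef, hnext _ (by rwa [triangle_next]), hnext _ ht, h.iff_flip _ ⟨p, hs, hp⟩]
  have ho : ∀ z : ℤ × ℤ, p ∈ triangle (z, 0) → p.1 + p.2 = z.1 + z.2 + 1 →
      (Q (z, 0) ↔ Q (z + (1, 0), 1)) := by
    intro z hz hx
    have hz' := mem_triangle_up.1 hz
    have e : next (z, 0) = (z + (1, 0), 2) := by
      simp only [next, zero_add, e0]
    have ef : next (flip (z + (1, 0), 2)) = (z + (1, 0), 1) := by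
      simp only [flip, next, e2, show (2 : ZMod 6) + 3 = 5 by decide, e5,
        show (5 : ZMod 6) + 2 = 1 by decide, add_assoc]; rfl
    have hs : p ∈ segment (z + (1, 0), 2) := by
      refine ⟨(p.2 - z.2, 0), ⟨⟨?_, le_rfl, ?_⟩, rfl⟩, ?_⟩
      · simp only; linarith
      · simp only; linarith
      · ext
        · simp only [point, toPlane, e2, Prod.fst_add, Prod.smul_fst, smul_eq_mul]
          push_cast
          linarith
        · simp [point, toPlane, e2]
    have ht : p ∈ triangle (flip (z + (1, 0), 2)) := by
      rw [← triangle_next, ef, mem_triangle_down]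
      simp only [Prod.fst_add, Prod.snd_add]
      push_cast
      refine ⟨?_, ?_, ?_⟩ <;> linarith
    rw [← ef, hnext _ ht, h.iff_flip _ ⟨p, hs, hp⟩, ← e, hnext _ hz]
  obtain ⟨x, y⟩ := p
  set a := ⌊x⌋ with ha
  set b := ⌊y⌋ with hb
  have hax : (a : ℝ) ≤ x := Int.floor_le x
  have hxa : x < a + 1 := Int.lt_floor_add_one x
  have hby : (b : ℝ) ≤ y := Int.floor_le y
  have hyb : y < b + 1 := Int.lt_floor_add_one y
  -- The canonical triangle at the point.
  let C : Prop := if x + y ≤ a + b + 1 then Q ((a, b), 0) else Q ((a + 1, b), 1)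
  have hup : ∀ z : ℤ × ℤ, (x, y) ∈ triangle (z, 0) → (Q (z, 0) ↔ C) := by
    rintro ⟨z1, z2⟩ hz
    obtain ⟨h1, h2, h3⟩ := mem_triangle_up.1 hz
    simp only at h1 h2 h3
    have i1 : z1 ≤ a := Int.le_floor.2 h1
    have i2 : z2 ≤ b := Int.le_floor.2 h2
    have i3 : a + b ≤ z1 + z2 + 1 := by
      have : ((a + b : ℤ) : ℝ) ≤ (z1 + z2 + 1 : ℤ) := by push_cast; linarith
      exact_mod_cast this
    have hcases : (z1 = a ∧ z2 = b) ∨ (z1 = a - 1 ∧ z2 = b) ∨ (z1 = a ∧ z2 = b - 1) := by omega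
    rcases hcases with ⟨rfl, rfl⟩ | ⟨rfl, rfl⟩ | ⟨rfl, rfl⟩
    · simp only [C, if_pos h3]
    · push_cast at h1 h3
      have hx : x = a := by linarith
      have hy : y = b := by linarith
      have hab : (x, y) ∈ triangle ((a, b), 0) := by
        rw [mem_triangle_up]; simp only; exact ⟨by linarith, by linarith, by linarith⟩
      have hC : C = Q ((a, b), 0) := if_pos (by linarith)
      rw [hC, ho _ hz (by simp only; push_cast; linarith), hv _ hab hx]
      simp
    · push_cast at h2 h3
      have hx : x = a := by linarith
      have hy : y = b := by linarith
      have hab : (x, y) ∈ triangle ((a, b), 0) := by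
        rw [mem_triangle_up]; simp only; exact ⟨by linarith, by linarith, by linarith⟩
      have hC : C = Q ((a, b), 0) := if_pos (by linarith)
      rw [hC, ho _ hz (by simp only; push_cast; linarith), hh _ hab hy]
      simp [sub_eq_add_neg]
  have hdown : ∀ z : ℤ × ℤ, (x, y) ∈ triangle (z, 1) → (Q (z, 1) ↔ C) := by
    rintro ⟨z1, z2⟩ hz
    obtain ⟨h1, h2, h3⟩ := mem_triangle_down.1 hz
    simp only at h1 h2 h3
    have i1 : a ≤ z1 := by
      have : (a : ℝ) ≤ z1 := by linarith
      exact_mod_cast this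
    have i2 : b ≤ z2 + 1 := by
      have : (b : ℝ) ≤ (z2 + 1 : ℤ) := by push_cast; linarith
      exact_mod_cast this
    have i3 : z1 + z2 < a + b + 2 := by
      have : ((z1 + z2 : ℤ) : ℝ) < (a + b + 2 : ℤ) := by push_cast; linarith
      exact_mod_cast this
    -- If the first coordinate is an integer, cross the edge of direction `ω`.
    have hxa' : z1 = a → (Q ((z1, z2), 1) ↔ C) := by
      rintro rfl
      have hx : x = a := by linarith
      have hab : (x, y) ∈ triangle ((a, z2), 0) := by
        rw [mem_triangle_up]; simp only; exact ⟨by linarith, by linarith, by linarith⟩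
      rw [← hv _ hab hx, hup _ hab]
    have hyb' : z2 = b - 1 → (Q ((z1, z2), 1) ↔ C) := by
      rintro rfl
      push_cast at h2 h3
      have hy : y = b := by linarith
      have hab : (x, y) ∈ triangle ((z1 - 1, b), 0) := by
        rw [mem_triangle_up]; simp only; push_cast
        exact ⟨by linarith, by linarith, by linarith⟩
      rw [← hup _ hab, hh _ hab hy]
      simp [sub_eq_add_neg]
    by_cases c1 : z1 = a
    · exact hxa' c1
    by_cases c2 : z2 = b - 1
    · exact hyb' c2
    obtain rfl : z1 = a + 1 := by omega
    obtain rfl : z2 = b := by omega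
    push_cast at h3
    by_cases hc : x + y ≤ a + b + 1
    · have hab : (x, y) ∈ triangle ((a, b), 0) := by
        rw [mem_triangle_up]; simp only; exact ⟨by linarith, by linarith, by linarith⟩
      rw [← hup _ hab, ho _ hab (by simp only; linarith)]
      simp
    · simp only [C, if_neg hc]
  have hall : ∀ d, (x, y) ∈ triangle d → (Q d ↔ C) := by
    intro d hd
    obtain ⟨z, k, hk, hz⟩ := exists_iterate_next d
    have key : (x, y) ∈ triangle (z, k) → (Q (z, k) ↔ C) := by
      rcases hk with rfl | rfl
      · exact hup z
      · exact hdown z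
    rcases hz with hz | hz | hz
    · rw [hz] at hd ⊢; exact key hd
    · rw [← hnext d hd, hz]; exact key (by rwa [← hz, triangle_next])
    · rw [← hnext d hd, ← hnext _ (by rwa [triangle_next]), hz]
      exact key (by rwa [← hz, triangle_next, triangle_next])
  rw [hall d hd, hall d' hd']

theorem exists_mem_triangle (p : ℝ × ℝ) : ∃ d, p ∈ triangle d := by
  have h1 := Int.floor_le p.1
  have h2 := Int.lt_floor_add_one p.1
  have h3 := Int.floor_le p.2
  have h4 := Int.lt_floor_add_one p.2
  by_cases h : p.1 + p.2 ≤ ⌊p.1⌋ + ⌊p.2⌋ + 1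
  · exact ⟨((⌊p.1⌋, ⌊p.2⌋), 0), mem_triangle_up.2 ⟨h1, h3, h⟩⟩
  · refine ⟨((⌊p.1⌋ + 1, ⌊p.2⌋), 1), mem_triangle_down.2 ⟨?_, ?_, ?_⟩⟩ <;> simp only <;>
      push_cast <;> linarith

theorem Propagates.iff_of_isPreconnected (h : Propagates S Q) (hS : IsPreconnected S)
    {d d' : LatticeDart} (hd : (triangle d ∩ S).Nonempty) (hd' : (triangle d' ∩ S).Nonempty) :
    Q d ↔ Q d' := by
  have hclosed : ∀ R : LatticeDart → Prop, IsClosed (⋃ e : {e // R e}, triangle e.1) := fun R =>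
    (locallyFinite_triangle.comp_injective Subtype.val_injective).isClosed_iUnion
      fun e => isClosed_triangle e.1
  by_contra hne
  obtain ⟨p, hp, hpS⟩ := hd
  obtain ⟨p', hp', hpS'⟩ := hd'
  have key := isPreconnected_closed_iff.1 hS _ _ (hclosed fun e => (Q e ↔ Q d))
    (hclosed fun e => ¬(Q e ↔ Q d)) ?_ ⟨p, hpS, Set.mem_iUnion.2 ⟨⟨d, Iff.rfl⟩, hp⟩⟩
    ⟨p', hpS', Set.mem_iUnion.2 ⟨⟨d', fun hh => hne hh.symm⟩, hp'⟩⟩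
  · obtain ⟨x, hx, h1, h2⟩ := key
    obtain ⟨⟨e, he⟩, hxe⟩ := Set.mem_iUnion.1 h1
    obtain ⟨⟨e', he'⟩, hxe'⟩ := Set.mem_iUnion.1 h2
    exact he' ((h.iff_of_mem hx hxe' hxe).trans he)
  · intro x _
    obtain ⟨e, he⟩ := exists_mem_triangle x
    by_cases hq : Q e ↔ Q d
    · exact Or.inl (Set.mem_iUnion.2 ⟨⟨e, hq⟩, he⟩)
    · exact Or.inr (Set.mem_iUnion.2 ⟨⟨e, hq⟩, he⟩)

end Propagation

/-- The six triangles at a lattice point cover a neighbourhood of it, in every direction `v`. -/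
theorem exists_add_smul_mem_triangle (w : ℤ × ℤ) (v : ℝ × ℝ) :
    ∃ k : ZMod 6, ∃ ε > (0 : ℝ), ∀ r : ℝ, 0 ≤ r → r ≤ ε → toPlane w + r • v ∈ triangle (w, k) := by
  have key : ∃ k : ZMod 6, ∃ α β : ℝ, 0 ≤ α ∧ 0 ≤ β ∧
      v = α • toPlane (unit k) + β • toPlane (unit (k + 1)) := by
    have e0 : unit 0 = (1, 0) := by decide
    have e1 : unit 1 = (0, 1) := by decide
    have e2 : unit 2 = (-1, 1) := by decide
    have e3 : unit 3 = (-1, 0) := by decide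
    have e4 : unit 4 = (0, -1) := by decide
    have e5 : unit 5 = (1, -1) := by decide
    obtain ⟨x, y⟩ := v
    rcases le_total 0 x with hx | hx <;> rcases le_total 0 y with hy | hy
    · exact ⟨0, x, y, hx, hy, by simp [toPlane, e0, e1]⟩
    · rcases le_total 0 (x + y) with hs | hs
      · refine ⟨5, -y, x + y, by linarith, hs, ?_⟩
        rw [show (5 : ZMod 6) + 1 = 0 by decide]
        simp [toPlane, e5, e0]
      · refine ⟨4, -(x + y), x, by linarith, hx, ?_⟩
        rw [show (4 : ZMod 6) + 1 = 5 by decide]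
        simp [toPlane, e4, e5]
    · rcases le_total 0 (x + y) with hs | hs
      · refine ⟨1, x + y, -x, hs, by linarith, ?_⟩
        rw [show (1 : ZMod 6) + 1 = 2 by decide]
        simp [toPlane, e1, e2]
      · refine ⟨2, y, -(x + y), hy, by linarith, ?_⟩
        rw [show (2 : ZMod 6) + 1 = 3 by decide]
        simp [toPlane, e2, e3]
    · refine ⟨3, -x, -y, by linarith, by linarith, ?_⟩
      rw [show (3 : ZMod 6) + 1 = 4 by decide]
      simp [toPlane, e3, e4]
  obtain ⟨k, α, β, hα, hβ, rfl⟩ := key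
  have hpos : 0 < α + β + 1 := by linarith
  refine ⟨k, 1 / (α + β + 1), by positivity, fun r hr hr' => ⟨(r * α, r * β), ⟨?_, ?_, ?_⟩, ?_⟩⟩
  · exact mul_nonneg hr hα
  · exact mul_nonneg hr hβ
  · rw [le_div_iff₀ hpos] at hr'
    simp only
    nlinarith
  · simp only [point]
    module

/-! ### The colouring of the lattice -/

/-- The residue of an Eisenstein integer modulo `1 + ω`; note that `ω ≡ -1`. -/
def residue (z : ℤ × ℤ) : ZMod 3 := z.1 - z.2

/-- The residue `(-1) ^ k` of `ω ^ k` modulo `1 + ω`. -/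
def sign (k : ZMod 6) : ZMod 3 := (-1) ^ k.val

theorem sign_add (k l : ZMod 6) : sign (k + l) = sign k * sign l := by
  revert k l; decide

theorem sign_mul_self (k : ZMod 6) : sign k * sign k = 1 := by
  revert k; decide

theorem residue_add (z w : ℤ × ℤ) : residue (z + w) = residue z + residue w := by
  simp only [residue, Prod.fst_add, Prod.snd_add]; push_cast; ring

theorem residue_sub (z w : ℤ × ℤ) : residue (z - w) = residue z - residue w := by
  simp only [residue, Prod.fst_sub, Prod.snd_sub]; push_cast; ring

theorem residue_zsmul (n : ℤ) (z : ℤ × ℤ) : residue (n • z) = n * residue z := by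
  simp only [residue, Prod.smul_fst, Prod.smul_snd, smul_eq_mul]; push_cast; ring

theorem residue_unit (k : ZMod 6) : residue (unit k) = sign k := by
  revert k; decide

theorem residue_rot (z : ℤ × ℤ) : residue (rot z) = -residue z := by
  have : (3 : ZMod 3) = 0 := by decide
  simp only [residue, rot]
  push_cast
  linear_combination -z.2 * this

theorem residue_rot_iterate (k : ℕ) (z : ℤ × ℤ) : residue (rot^[k] z) = (-1) ^ k * residue z := by
  induction k with
  | zero => simp
  | succ k ih => rw [Function.iterate_succ_apply', residue_rot, ih]; ring

theorem residue_latticePoint (d : LatticeDart) (w : ℤ × ℤ) :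
    residue (latticePoint d w) = residue d.1 + sign d.2 * residue w := by
  have h : sign 1 = -1 := by decide
  rw [latticePoint, residue_add, residue_add, residue_zsmul, residue_zsmul, residue_unit,
    residue_unit, sign_add, h, show residue w = w.1 - w.2 from rfl]
  ring

theorem exists_isCoxeter (z : ℤ × ℤ) : ∃ a b, IsCoxeter z a b := by
  obtain ⟨x, y⟩ := z
  have key : ∀ (k : ℕ) (a b : ℤ), 0 ≤ a → 0 ≤ b → (x, y) = rot^[k] (a, b) →
      ∃ a b, IsCoxeter (x, y) a b := by
    intro k a b ha hb h
    lift a to ℕ using ha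
    lift b to ℕ using hb
    exact ⟨a, b, k, h⟩
  rcases le_total 0 x with hx | hx <;> rcases le_total 0 y with hy | hy
  · exact key 0 x y hx hy rfl
  · rcases le_total 0 (x + y) with hs | hs
    · exact key 5 (-y) (x + y) (by omega) hs (by simp [rot])
    · exact key 4 (-(x + y)) x (by omega) hx (by simp [rot])
  · rcases le_total 0 (x + y) with hs | hs
    · exact key 1 (x + y) (-x) hs (by omega) (by simp [rot])
    · exact key 2 y (-(x + y)) hy (by omega) (by simp [rot])
  · exact key 3 (-x) (-y) (by omega) (by omega) (by simp [rot])

theorem IsCoxeter.modEq_iff {z : ℤ × ℤ} {a b : ℕ} (h : IsCoxeter z a b) :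
    a ≡ b [MOD 3] ↔ residue z = 0 := by
  obtain ⟨k, rfl⟩ := h
  have hu : IsUnit ((-1 : ZMod 3) ^ k) := (isUnit_one.neg).pow k
  rw [residue_rot_iterate, hu.mul_right_eq_zero, residue, sub_eq_zero, ← ZMod.natCast_eq_natCast_iff]
  push_cast
  rfl

/-- The colouring of the oriented edges of the lattice in which the points of residue `s` are
marked. -/
def latticeColor (s : ZMod 3) (d : LatticeDart) : ZMod 3 := sign d.2 * (residue d.1 - s)

theorem latticeColor_next (s : ZMod 3) (d : LatticeDart) :
    latticeColor s (next d) = latticeColor s d + 1 := by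
  have h : sign 2 = 1 := by decide
  simp only [latticeColor, next, residue_add, residue_unit, sign_add, h]
  linear_combination sign_mul_self d.2

theorem latticeColor_flip (s : ZMod 3) (d : LatticeDart) :
    latticeColor s (flip d) = 2 - latticeColor s d := by
  have h : sign 3 = -1 := by decide
  have h3 : (3 : ZMod 3) = 0 := by decide
  simp only [latticeColor, flip, residue_add, residue_unit, sign_add, h]
  linear_combination -sign_mul_self d.2 - h3

end Eisenstein

/-! ### Plane convex geometry -/

/-- A triangle minus finitely many points is connected: two points can be joined by two segments
through a point of an arc of a parabola, because every line meets the parabola at most twice. -/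
theorem Eisenstein.isPreconnected_simplex_diff {E : Set (ℝ × ℝ)} (hE : E.Finite) :
    IsPreconnected (simplex \ E) := by
  have hbad : ∀ a e : ℝ × ℝ, e ≠ a →
      {t : ℝ | (e.1 - a.1) * (t ^ 2 - a.2) - (e.2 - a.2) * (t - a.1) = 0}.Finite := by
    intro a e hne
    let p : Polynomial ℝ := .C (e.1 - a.1) * (.X ^ 2 - .C a.2) - .C (e.2 - a.2) * (.X - .C a.1)
    have hp : p ≠ 0 := by
      intro h0
      have heval : ∀ t : ℝ, (e.1 - a.1) * (t ^ 2 - a.2) - (e.2 - a.2) * (t - a.1) = 0 := by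
        intro t
        simpa [p] using congrArg (Polynomial.eval t) h0
      have h1 := heval 0
      have h2 := heval 1
      have h3 := heval (-1)
      exact hne (Prod.ext (by linarith) (by linarith))
    refine (p.rootSet_finite ℝ).subset fun t ht => ?_
    rw [Polynomial.mem_rootSet]
    refine ⟨hp, ?_⟩
    simpa [p] using ht
  refine isPreconnected_of_forall_pair fun a ha b hb => ?_
  have hfin : (⋃ e ∈ E,
      {t : ℝ | (e.1 - a.1) * (t ^ 2 - a.2) - (e.2 - a.2) * (t - a.1) = 0} ∪
      {t : ℝ | (e.1 - b.1) * (t ^ 2 - b.2) - (e.2 - b.2) * (t - b.1) = 0}).Finite := by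
    refine hE.biUnion fun e he => (hbad a e ?_).union (hbad b e ?_)
    · rintro rfl; exact ha.2 he
    · rintro rfl; exact hb.2 he
  obtain ⟨t, ht, htE⟩ := ((Set.Icc_infinite (show (0 : ℝ) < 1 / 2 by norm_num)).sdiff hfin).nonempty
  have hc : (t, t ^ 2) ∈ simplex := by
    refine ⟨ht.1, sq_nonneg t, ?_⟩
    have := ht.1
    have := ht.2
    simp only
    nlinarith
  have hseg : ∀ x ∈ simplex \ E, (∀ e ∈ E,
      (e.1 - x.1) * (t ^ 2 - x.2) - (e.2 - x.2) * (t - x.1) ≠ 0) →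
      _root_.segment ℝ x (t, t ^ 2) ⊆ simplex \ E := by
    intro x hx hx' y hy
    refine ⟨convex_simplex.segment_subset hx.1 hc hy, fun hyE => hx' y hyE ?_⟩
    obtain ⟨α, β, -, -, hαβ, rfl⟩ := hy
    simp only [Prod.fst_add, Prod.snd_add, Prod.smul_fst, Prod.smul_snd, smul_eq_mul]
    obtain rfl : α = 1 - β := by linarith
    ring
  simp only [Set.mem_iUnion, not_exists, Set.mem_union, Set.mem_ofPred_eq, not_or] at htE
  refine ⟨_root_.segment ℝ a (t, t ^ 2) ∪ _root_.segment ℝ b (t, t ^ 2),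
    Set.union_subset (hseg a ha fun e he => (htE e he).1) (hseg b hb fun e he => (htE e he).2),
    Or.inl (left_mem_segment ℝ _ _), Or.inr (left_mem_segment ℝ _ _), ?_⟩
  exact IsPreconnected.union (t, t ^ 2) (right_mem_segment ℝ _ _) (right_mem_segment ℝ _ _)
    (convex_segment _ _).isPreconnected (convex_segment _ _).isPreconnected

/-- A point `m` of a polygon that lies on its boundary and inside a segment `a b` of it lies on
a side, and so it sees a corner in the direction from `a` to `b`. -/
theorem exists_corner_of_notMem_interior {ι : Type*} (c : ι → ℝ × ℝ)
    (hint : (interior (convexHull ℝ (Set.range c))).Nonempty) {a b m : ℝ × ℝ}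
    (ha : a ∈ convexHull ℝ (Set.range c)) (hb : b ∈ convexHull ℝ (Set.range c)) (hab : a ≠ b)
    (hm : m ∈ openSegment ℝ a b) (hmint : m ∉ interior (convexHull ℝ (Set.range c)))
    (hmc : ∀ i, c i ≠ m) :
    ∃ i, ∃ r > (0 : ℝ), c i = m + r • (b - a) := by
  have hmem : m ∈ convexHull ℝ (Set.range c) :=
    (convex_convexHull ℝ _).openSegment_subset ha hb hm
  obtain ⟨f, hf0, hf⟩ := geometric_hahn_banach_of_nonempty_interior_point
    (convex_convexHull ℝ _) hmint hint
  have hfle : ∀ x ∈ convexHull ℝ (Set.range c), f x ≤ f m := hf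
  set v := b - a with hv
  have hfv : f v = 0 := by
    obtain ⟨α, β, hα, hβ, hαβ, rfl⟩ := hm
    have h1 := hfle a ha
    have h2 := hfle b hb
    simp only [map_add, map_smul, smul_eq_mul] at h1 h2
    rw [hv, map_sub]
    obtain rfl : α = 1 - β := by linarith
    have h3 : 0 ≤ β * (f b - f a) := by linarith
    have h4 : 0 ≤ (1 - β) * (f a - f b) := by linarith
    have h5 := nonneg_of_mul_nonneg_right h3 hβ
    have h6 := nonneg_of_mul_nonneg_right h4 hα
    linarith
  have hcoord : ∀ y : ℝ × ℝ, f y = y.1 * f (1, 0) + y.2 * f (0, 1) := by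
    intro y
    have : y = y.1 • ((1, 0) : ℝ × ℝ) + y.2 • ((0, 1) : ℝ × ℝ) := by ext <;> simp
    conv_lhs => rw [this, map_add, map_smul, map_smul, smul_eq_mul, smul_eq_mul]
  have hv0 : v ≠ 0 := sub_ne_zero.2 hab.symm
  have hvv : 0 < v.1 * v.1 + v.2 * v.2 := by
    by_contra h
    have h1 : v.1 = 0 := by nlinarith [mul_self_nonneg v.1, mul_self_nonneg v.2]
    have h2 : v.2 = 0 := by nlinarith [mul_self_nonneg v.1, mul_self_nonneg v.2]
    exact hv0 (Prod.ext h1 h2)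
  -- Otherwise all corners lie in a convex set without `m`: an open half-plane and an open ray.
  let T : Set (ℝ × ℝ) := {y | f y < f m ∨
    (f y = f m ∧ v.1 * y.1 + v.2 * y.2 < v.1 * m.1 + v.2 * m.2)}
  have hT : Convex ℝ T := by
    refine convex_iff_forall_pos.2 fun x hx y hy α β hα hβ hαβ => ?_
    obtain rfl : α = 1 - β := by linarith
    have e : f ((1 - β) • x + β • y) = (1 - β) * f x + β * f y := by
      simp only [map_add, map_smul, smul_eq_mul]
    simp only [T, Set.mem_ofPred_eq, e, Prod.fst_add, Prod.snd_add, Prod.smul_fst, Prod.smul_snd,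
      smul_eq_mul] at hx hy ⊢
    rcases hx with hx | ⟨hx, hx'⟩ <;> rcases hy with hy | ⟨hy, hy'⟩
    · left; nlinarith
    · left; rw [hy]; nlinarith
    · left; rw [hx]; nlinarith
    · right
      refine ⟨by rw [hx, hy]; ring, ?_⟩
      nlinarith
  have hsub : ¬ Set.range c ⊆ T := by
    intro h
    have := convexHull_min h hT hmem
    simp [T] at this
  obtain ⟨_, ⟨i, rfl⟩, hi⟩ := Set.not_subset.1 hsub
  have h1 := hfle (c i) (subset_convexHull ℝ _ ⟨i, rfl⟩)
  simp only [T, Set.mem_ofPred_eq, not_or, not_and, not_lt] at hi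
  have h2 : f (c i) = f m := le_antisymm h1 hi.1
  have h3 := hi.2 h2
  have hdet : ((c i).1 - m.1) * v.2 = ((c i).2 - m.2) * v.1 := by
    rw [hcoord, hcoord m] at h2
    rw [hcoord] at hfv
    by_cases h0 : f (1, 0) = 0
    · have h0' : f (0, 1) ≠ 0 := by
        intro h0'
        apply hf0
        ext <;> simp [h0, h0']
      apply mul_left_cancel₀ h0'
      linear_combination ((c i).1 - m.1) * hfv - v.1 * h2
    · apply mul_left_cancel₀ h0
      linear_combination v.2 * h2 - ((c i).2 - m.2) * hfv
  set r := (v.1 * ((c i).1 - m.1) + v.2 * ((c i).2 - m.2)) / (v.1 * v.1 + v.2 * v.2) with hr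
  have hci : c i = m + r • v := by
    have hr' := div_mul_cancel₀ (v.1 * ((c i).1 - m.1) + v.2 * ((c i).2 - m.2)) hvv.ne'
    rw [← hr] at hr'
    ext
    · apply mul_left_cancel₀ hvv.ne'
      simp only [Prod.fst_add, Prod.smul_fst, smul_eq_mul]
      linear_combination v.2 * hdet - v.1 * hr'
    · apply mul_left_cancel₀ hvv.ne'
      simp only [Prod.snd_add, Prod.smul_snd, smul_eq_mul]
      linear_combination -v.1 * hdet - v.2 * hr'
  refine ⟨i, r, lt_of_le_of_ne (div_nonneg (by linarith) hvv.le) fun h => hmc i ?_, hci⟩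
  rw [hci, ← h, zero_smul, add_zero]

/-- A triangle that is not degenerate has interior points. -/
theorem interior_convexHull_nonempty_of_det_pos {s : Set (ℝ × ℝ)} {a b c : ℝ × ℝ}
    (ha : a ∈ s) (hb : b ∈ s) (hc : c ∈ s)
    (h : 0 < (b.1 - a.1) * (c.2 - a.2) - (b.2 - a.2) * (c.1 - a.1)) :
    (interior (convexHull ℝ s)).Nonempty := by
  set D := (b.1 - a.1) * (c.2 - a.2) - (b.2 - a.2) * (c.1 - a.1) with hD
  let σ : ℝ × ℝ → ℝ := fun p => (p.1 - a.1) * (c.2 - a.2) - (p.2 - a.2) * (c.1 - a.1)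
  let τ : ℝ × ℝ → ℝ := fun p => (b.1 - a.1) * (p.2 - a.2) - (b.2 - a.2) * (p.1 - a.1)
  let U : Set (ℝ × ℝ) := {p | 0 < σ p} ∩ {p | 0 < τ p} ∩ {p | σ p + τ p < D}
  have hσ : Continuous σ := by fun_prop
  have hτ : Continuous τ := by fun_prop
  have hU : IsOpen U := ((isOpen_lt continuous_const hσ).inter (isOpen_lt continuous_const hτ)).inter
    (isOpen_lt (hσ.add hτ) continuous_const)
  have hsub : U ⊆ convexHull ℝ s := by
    rintro p ⟨⟨h1, h2⟩, h3⟩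
    simp only [Set.mem_ofPred_eq] at h1 h2 h3
    have hp : p = ((D - σ p - τ p) / D) • a + (σ p / D) • b + (τ p / D) • c := by
      have := h.ne'
      ext <;> simp only [Prod.fst_add, Prod.snd_add, Prod.smul_fst, Prod.smul_snd, smul_eq_mul] <;>
        field_simp <;> simp only [hD, σ, τ] <;> ring
    have hw : ∀ i, 0 ≤ (![(D - σ p - τ p) / D, σ p / D, τ p / D] : Fin 3 → ℝ) i := by
      intro i
      fin_cases i
      · exact div_nonneg (by linarith) h.le
      · exact div_nonneg h1.le h.le
      · exact div_nonneg h2.le h.le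
    have hz : ∀ i, (![a, b, c] : Fin 3 → ℝ × ℝ) i ∈ convexHull ℝ s := by
      intro i
      fin_cases i
      · exact subset_convexHull ℝ s ha
      · exact subset_convexHull ℝ s hb
      · exact subset_convexHull ℝ s hc
    have hsum : ∑ i, (![(D - σ p - τ p) / D, σ p / D, τ p / D] : Fin 3 → ℝ) i = 1 := by
      simp only [Fin.sum_univ_three, Matrix.cons_val]
      rw [← add_div, ← add_div, div_eq_one_iff_eq h.ne']
      ring
    have := (convex_convexHull ℝ s).sum_mem (fun i _ => hw i) hsum fun i _ => hz i
    rw [hp]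
    simpa [Fin.sum_univ_three] using this
  refine Set.Nonempty.mono (interior_maximal hsub hU)
    ⟨((a.1 + b.1 + c.1) / 3, (a.2 + b.2 + c.2) / 3), ⟨?_, ?_⟩, ?_⟩ <;>
    simp only [Set.mem_ofPred_eq, σ, τ] <;> nlinarith

/-! ### Unfolded facets -/

theorem Fin.two_ne_zero_and_one (n : ℕ) : (2 : Fin (n + 3)) ≠ 0 ∧ (2 : Fin (n + 3)) ≠ 1 := by
  have h2 : 2 % (n + 3) = 2 := Nat.mod_eq_of_lt (by omega)
  have h1 : 1 % (n + 3) = 1 := Nat.mod_eq_of_lt (by omega)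
  refine ⟨fun h => ?_, fun h => ?_⟩
  · have h' : 2 % (n + 3) = 0 := congrArg Fin.val h
    omega
  · have h' : 2 % (n + 3) = 1 % (n + 3) := congrArg Fin.val h
    omega

namespace UnfoldedFacet

open Eisenstein

variable {F : CubicMap}

theorem unfold_next (f : UnfoldedFacet F) {d : LatticeDart} (h : (triangle d ∩ f.region).Nonempty) :
    f.unfold (next d) = F.vert (f.unfold d) :=
  f.isUnfolding.map_next d h

theorem unfold_flip (f : UnfoldedFacet F) {d : LatticeDart} (h : (segment d ∩ f.region).Nonempty) :
    f.unfold (Eisenstein.flip d) = F.flip (f.unfold d) :=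
  f.isUnfolding.map_flip d h

theorem toPlane_corner_mem_hull (f : UnfoldedFacet F) (i : Fin (f.extra + 3)) :
    toPlane (f.corner i) ∈ f.hull :=
  subset_convexHull ℝ _ ⟨i, rfl⟩

theorem convex_hull (f : UnfoldedFacet F) : Convex ℝ f.hull :=
  convex_convexHull ℝ _

theorem isCompact_hull (f : UnfoldedFacet F) : IsCompact f.hull :=
  (Set.finite_range fun i => toPlane (f.corner i)).isCompact_convexHull ℝ

theorem interior_hull_nonempty (f : UnfoldedFacet F) : (interior f.hull).Nonempty := by
  obtain ⟨h0, h1⟩ := Fin.two_ne_zero_and_one f.extra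
  have h := f.convex 0 2 h0 (by rwa [zero_add])
  refine interior_convexHull_nonempty_of_det_pos (a := toPlane (f.corner 0))
    (b := toPlane (f.corner (0 + 1))) (c := toPlane (f.corner 2)) ⟨_, rfl⟩ ⟨_, rfl⟩ ⟨_, rfl⟩ ?_
  have : (0 : ℝ) < (Eisenstein.det (f.corner (0 + 1) - f.corner 0) (f.corner 2 - f.corner 0) : ℤ) :=
    Int.cast_pos.2 h
  simpa [Eisenstein.det, toPlane] using this

/-- Going around a lattice point of a facet that is not a corner takes six steps. -/
theorem faceSize_ne_five (f : UnfoldedFacet F) {w : ℤ × ℤ} (hw : toPlane w ∈ f.region)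
    (k : ZMod 6) : F.faceSize (f.unfold (w, k)) ≠ 5 := by
  have hk6 : ∀ k : ZMod 6, k + 1 + 3 + 2 = k := by decide
  have hk7 : ∀ k : ZMod 6, k + 1 + 3 + 3 = k + 1 := by decide
  have hring : ∀ k, F.ring (f.unfold (w, k)) = f.unfold (w, k + 1) := by
    intro k
    -- The edge of the triangle on the left of `(w, k)` that ends at `w`.
    let e : LatticeDart := (w + unit (k + 1), k + 1 + 3)
    have he : next e = (w, k) := by
      simp only [e, next, unit_add_three, add_neg_cancel_right]
      rw [show k + 1 + 3 + 2 = k from hk6 k]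
    have he' : Eisenstein.flip e = (w, k + 1) := by
      simp only [e, Eisenstein.flip, unit_add_three, add_neg_cancel_right]
      rw [show k + 1 + 3 + 3 = k + 1 from hk7 k]
    have hs : toPlane w ∈ segment e := by
      refine ⟨(1, 0), by simp [simplex], ?_⟩
      simp only [e, point, unit_add_three, toPlane_add, toPlane_neg]
      module
    rw [CubicMap.ring_apply, ← he, f.unfold_next ⟨_, segment_subset_triangle _ hs, hw⟩,
      CubicMap.perm_inv_apply_self, ← f.unfold_flip ⟨_, hs, hw⟩, he']
  have hk : k + 1 + 1 + 1 + 1 + 1 + 1 = k := by revert k; decide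
  intro h5
  have hper : F.ring^[6] (f.unfold (w, k)) = f.unfold (w, k) := by
    simp only [Function.iterate_succ, Function.iterate_zero, Function.comp_apply, id_eq, hring, hk]
  have hdvd : F.faceSize (f.unfold (w, k)) ∣ 6 := Function.IsPeriodicPt.minimalPeriod_dvd hper
  rw [h5] at hdvd
  omega

theorem faceSize_corner (f : UnfoldedFacet F) (i : Fin (f.extra + 3)) (k : ZMod 6)
    (h : (triangle (f.corner i, k) ∩ f.region).Nonempty) :
    F.faceSize (f.unfold (f.corner i, k)) = 5 :=
  f.pentagon i k h

/-- A colouring of the surface and a colouring of the lattice stay equal along the facet. -/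
theorem propagates_color (f : UnfoldedFacet F) {c : F.Dart → ZMod 3} (hc : F.IsColoring c)
    (s : ZMod 3) : Propagates f.region fun d => c (f.unfold d) = latticeColor s d where
  iff_next d hd := by
    rw [f.unfold_next hd, hc.vert, latticeColor_next, add_left_inj]
  iff_flip d hd := by
    rw [f.unfold_flip hd, hc.flip, latticeColor_flip, sub_right_inj]

theorem openSegment_subset_region (f : UnfoldedFacet F) (i : Fin (f.extra + 3)) :
    openSegment ℝ (toPlane (f.corner i)) (toPlane (f.corner (i + 1))) ⊆ f.region := by
  rintro _ ⟨α, β, hα, hβ, hαβ, rfl⟩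
  refine ⟨f.convex_hull (f.toPlane_corner_mem_hull i) (f.toPlane_corner_mem_hull (i + 1))
    hα.le hβ.le hαβ, ?_⟩
  -- A third corner, which witnesses that the ends of the side are distinct.
  have hne : f.corner (i + 1) ≠ f.corner i := by
    intro he
    obtain ⟨h0, h1⟩ := Fin.two_ne_zero_and_one f.extra
    have h := f.convex i (i + 2) (fun h => h0 (add_eq_left.1 h)) fun h => h1 (add_left_cancel h)
    rw [he, sub_self] at h
    simp [Eisenstein.det] at h
  have hne' : toPlane (f.corner (i + 1)) - toPlane (f.corner i) ≠ 0 :=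
    sub_ne_zero.2 fun h => hne (toPlane_injective h)
  obtain rfl : α = 1 - β := by linarith
  rintro ⟨j, hj⟩
  simp only at hj
  have hj' : toPlane (f.corner j) - toPlane (f.corner i) =
      β • (toPlane (f.corner (i + 1)) - toPlane (f.corner i)) := by
    rw [hj]; module
  by_cases hji : j = i
  · subst hji
    rw [sub_self, eq_comm, smul_eq_zero] at hj'
    exact hj'.elim hβ.ne' hne'
  by_cases hji' : j = i + 1
  · subst hji'
    have : (1 - β) • (toPlane (f.corner (i + 1)) - toPlane (f.corner i)) = 0 := by
      rw [sub_smul, ← hj', one_smul, sub_self]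
    rw [smul_eq_zero] at this
    exact this.elim hα.ne' hne'
  · have h := f.convex i j hji hji'
    have h' : (0 : ℝ) < (Eisenstein.det (f.corner (i + 1) - f.corner i)
      (f.corner j - f.corner i) : ℤ) := Int.cast_pos.2 h
    simp only [toPlane, Prod.ext_iff, Prod.fst_sub, Prod.snd_sub, Prod.smul_fst, Prod.smul_snd,
      smul_eq_mul] at hj'
    simp only [Eisenstein.det, Prod.fst_sub, Prod.snd_sub] at h'
    push_cast at h'
    rw [hj'.1, hj'.2] at h'
    linarith

/-- Both ends of a master edge are marked, because they are pentagons, and the colouring of the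
facet along the edge is that of the lattice. -/
theorem residue_side_eq_zero (f : UnfoldedFacet F) {c : F.Dart → ZMod 3} (hc : F.IsColoring c)
    (i : Fin (f.extra + 3)) : residue (f.side i) = 0 := by
  have hS := f.openSegment_subset_region i
  set A := toPlane (f.corner i) with hA
  set B := toPlane (f.corner (i + 1)) with hB
  obtain ⟨k, ε, hε, hk⟩ := exists_add_smul_mem_triangle (f.corner i) (B - A)
  obtain ⟨k', ε', hε', hk'⟩ := exists_add_smul_mem_triangle (f.corner (i + 1)) (A - B)
  have h1 : (triangle (f.corner i, k) ∩ openSegment ℝ A B).Nonempty := by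
    have h0 : 0 < min ε (1 / 2) := lt_min hε (by norm_num)
    refine ⟨_, hk (min ε (1 / 2)) h0.le (min_le_left _ _), 1 - min ε (1 / 2), min ε (1 / 2), ?_, h0,
      by ring, by rw [← hA]; module⟩
    linarith [min_le_right ε (1 / 2)]
  have h2 : (triangle (f.corner (i + 1), k') ∩ openSegment ℝ A B).Nonempty := by
    have h0 : 0 < min ε' (1 / 2) := lt_min hε' (by norm_num)
    refine ⟨_, hk' (min ε' (1 / 2)) h0.le (min_le_left _ _), min ε' (1 / 2), 1 - min ε' (1 / 2), h0,
      ?_, by ring, by rw [← hB]; module⟩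
    linarith [min_le_right ε' (1 / 2)]
  have hc1 := hc.eq_zero_of_faceSize
    (f.faceSize_corner i k (h1.mono (Set.inter_subset_inter_right _ hS)))
  have hc2 := hc.eq_zero_of_faceSize
    (f.faceSize_corner (i + 1) k' (h2.mono (Set.inter_subset_inter_right _ hS)))
  have key := ((f.propagates_color hc (residue (f.corner i))).mono hS).iff_of_isPreconnected
    (convex_openSegment A B).isPreconnected h1 h2
  have h3 := key.1 (by rw [hc1, latticeColor]; ring)
  rw [hc2, latticeColor] at h3
  have h4 : sign k' * (sign k' * (residue (f.corner (i + 1)) - residue (f.corner i))) = 0 := by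
    rw [← h3, mul_zero]
  rw [← mul_assoc, sign_mul_self, one_mul] at h4
  rw [side, residue_sub, h4]

theorem residue_corner (f : UnfoldedFacet F) (h : ∀ i, residue (f.side i) = 0)
    (i : Fin (f.extra + 3)) : residue (f.corner i) = residue (f.corner 0) := by
  induction i using Fin.induction with
  | zero => rfl
  | succ i ih =>
    have := h i.castSucc
    rw [side, residue_sub, ih, sub_eq_zero, Fin.coeSucc_eq_succ] at this
    exact this

/-! ### Colouring the facets -/

/-- The colouring of a facet in which its first corner is marked. -/
def color (f : UnfoldedFacet F) (d : LatticeDart) : ZMod 3 := latticeColor (residue (f.corner 0)) d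

/-- Two facets unfolded from a common dart of the surface stay equal along their common points. -/
theorem propagates_place (f g : UnfoldedFacet F) (d d' : LatticeDart) {S : Set (ℝ × ℝ)}
    (hf : ∀ x ∈ S, point d x ∈ f.region) (hg : ∀ x ∈ S, point d' x ∈ g.region) :
    Propagates S fun e => f.unfold (place d e) = g.unfold (place d' e) where
  iff_next e := by
    rintro ⟨x, hx, hxS⟩
    rw [place_next, place_next,
      f.unfold_next ⟨_, triangle_place d e ▸ Set.mem_image_of_mem _ hx, hf x hxS⟩,
      g.unfold_next ⟨_, triangle_place d' e ▸ Set.mem_image_of_mem _ hx, hg x hxS⟩,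
      F.vert.apply_eq_iff_eq]
  iff_flip e := by
    rintro ⟨x, hx, hxS⟩
    rw [place_flip, place_flip,
      f.unfold_flip ⟨_, segment_place d e ▸ Set.mem_image_of_mem _ hx, hf x hxS⟩,
      g.unfold_flip ⟨_, segment_place d' e ▸ Set.mem_image_of_mem _ hx, hg x hxS⟩,
      F.flip.apply_eq_iff_eq]

/-- The positive parameters at which the ray from `m` with the direction `v` meets a corner of the
facet, all in the coordinates relative to the oriented edge `d`. -/
def rayCorners (f : UnfoldedFacet F) (d : LatticeDart) (m v : ℝ × ℝ) : Set ℝ :=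
  {r | 0 < r ∧ ∃ i, toPlane (f.corner i) = point d (m + r • v)}

theorem finite_rayCorners (f : UnfoldedFacet F) (d : LatticeDart) (m : ℝ × ℝ) {v : ℝ × ℝ}
    (hv : v ≠ 0) : (f.rayCorners d m v).Finite := by
  refine ((Set.finite_range fun i => toPlane (f.corner i)).preimage
    (f := fun r : ℝ => point d (m + r • v)) ?_).subset ?_
  · intro r _ r' _ h
    exact smul_left_injective ℝ hv (add_left_cancel (point_injective d h))
  · rintro r ⟨-, hr⟩
    exact hr

theorem mem_hull_of_ray (f : UnfoldedFacet F) {d : LatticeDart} {m v : ℝ × ℝ} {r₁ r : ℝ}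
    (hm : point d m ∈ f.region) (h1 : r₁ ∈ f.rayCorners d m v) (hr : 0 ≤ r) (hrr : r ≤ r₁) :
    point d (m + r • v) ∈ f.hull := by
  obtain ⟨hpos, i, hi⟩ := h1
  have hc := f.toPlane_corner_mem_hull i
  rw [hi, point_add_smul] at hc
  have := f.convex_hull hm.1 hc (a := 1 - r / r₁) (b := r / r₁)
    (sub_nonneg.2 ((div_le_one hpos).2 hrr)) (div_nonneg hr hpos.le) (by ring)
  rw [point_add_smul]
  convert! this using 1
  have e : r = r / r₁ * r₁ := by field_simp
  nth_rw 1 [e]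
  module

theorem mem_region_of_ray (f : UnfoldedFacet F) {d : LatticeDart} {m v : ℝ × ℝ} {r₀ r₁ r : ℝ}
    (hm : point d m ∈ f.region) (h1 : r₁ ∈ f.rayCorners d m v)
    (hmin : ∀ r ∈ f.rayCorners d m v, r₀ ≤ r) (hr : 0 ≤ r) (hrr : r < r₀) :
    point d (m + r • v) ∈ f.region := by
  refine ⟨f.mem_hull_of_ray hm h1 hr (hrr.le.trans (hmin _ h1)), ?_⟩
  rcases hr.eq_or_lt with rfl | hpos
  · rw [zero_smul, add_zero]
    exact hm.2
  · rintro ⟨i, hi⟩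
    exact absurd (hmin r ⟨hpos, i, hi⟩) (not_le.2 hrr)

/-- Two facets that share a point and a ray from there to a corner of the first have this corner in
common, because a lattice point of the second that is not a corner is a hexagon.  As the corner is
marked in both facets, their colourings agree. -/
theorem color_eq_of_isLeast (f g : UnfoldedFacet F) (hf : ∀ i, residue (f.side i) = 0)
    (hg : ∀ i, residue (g.side i) = 0) {d d' : LatticeDart} (hd : f.unfold d = g.unfold d')
    {m v : ℝ × ℝ} (hms : m ∈ simplex) (hm : point d m ∈ f.region) (hm' : point d' m ∈ g.region)
    {r₀ r₁ : ℝ} (h0 : r₀ ∈ f.rayCorners d m v) (h1 : r₁ ∈ g.rayCorners d' m v)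
    (hmin : ∀ r ∈ f.rayCorners d m v, r₀ ≤ r) (hmin' : ∀ r ∈ g.rayCorners d' m v, r₀ ≤ r) :
    f.color d = g.color d' := by
  have hpos : 0 < r₀ := h0.1
  obtain ⟨-, i, hi⟩ := h0
  obtain ⟨w, hw⟩ := exists_latticePoint_eq d (f.corner i)
  have hwm : toPlane w = m + r₀ • v := by
    rw [← hw, toPlane_latticePoint] at hi
    exact point_injective d hi
  let S : Set (ℝ × ℝ) := (fun r : ℝ => m + r • v) '' Set.Ico 0 r₀
  have hS : IsPreconnected S := isPreconnected_Ico.image _ (by fun_prop)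
  have hSf : ∀ x ∈ S, point d x ∈ f.region := by
    rintro _ ⟨r, hr, rfl⟩
    exact f.mem_region_of_ray hm ⟨hpos, i, hi⟩ hmin hr.1 hr.2
  have hSg : ∀ x ∈ S, point d' x ∈ g.region := by
    rintro _ ⟨r, hr, rfl⟩
    exact g.mem_region_of_ray hm' h1 hmin' hr.1 hr.2
  obtain ⟨k, ε, hε, hk⟩ := exists_add_smul_mem_triangle w (-v)
  have hkS : (triangle (w, k) ∩ S).Nonempty := by
    have h2 : 0 < min ε r₀ := lt_min hε hpos
    refine ⟨_, hk (min ε r₀) h2.le (min_le_left _ _), r₀ - min ε r₀,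
      ⟨sub_nonneg.2 (min_le_right _ _), by linarith⟩, ?_⟩
    rw [hwm]
    module
  have hmS : (triangle ((0, 0), 0) ∩ S).Nonempty :=
    ⟨m, triangle_origin ▸ hms, 0, ⟨le_rfl, hpos⟩, by simp⟩
  have key : f.unfold (place d (w, k)) = g.unfold (place d' (w, k)) :=
    ((f.propagates_place g d d' hSf hSg).iff_of_isPreconnected hS hmS hkS).1
      (by rwa [place_origin, place_origin])
  have h5 : F.faceSize (f.unfold (place d (w, k))) = 5 := by
    obtain ⟨x, hx, hxS⟩ := hkS
    have hx' : point d x ∈ triangle (place d (w, k)) :=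
      triangle_place d (w, k) ▸ Set.mem_image_of_mem _ hx
    have e : place d (w, k) = (f.corner i, d.2 + k) := by rw [place, hw]
    rw [e] at hx' ⊢
    exact f.faceSize_corner i _ ⟨_, hx', hSf x hxS⟩
  have hj : ∃ j, g.corner j = latticePoint d' w := by
    by_contra hj
    rw [key] at h5
    refine g.faceSize_ne_five ⟨?_, ?_⟩ _ h5
    · rw [toPlane_latticePoint, hwm]
      exact g.mem_hull_of_ray hm' h1 hpos.le (hmin' _ h1)
    · rintro ⟨j, h⟩
      exact hj ⟨j, toPlane_injective h⟩
  obtain ⟨j, hj⟩ := hj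
  have ef := congrArg residue hw
  have eg := congrArg residue hj
  rw [residue_latticePoint, f.residue_corner hf] at ef
  rw [residue_latticePoint, g.residue_corner hg] at eg
  rw [color, color, latticeColor, latticeColor, ← ef, eg]
  linear_combination -residue w * Eisenstein.sign_mul_self d.2 +
    residue w * Eisenstein.sign_mul_self d'.2

theorem color_eq_of_rayCorners (f g : UnfoldedFacet F) (hf : ∀ i, residue (f.side i) = 0)
    (hg : ∀ i, residue (g.side i) = 0) {d d' : LatticeDart} (hd : f.unfold d = g.unfold d')
    {m v : ℝ × ℝ} (hms : m ∈ simplex) (hv : v ≠ 0) (hm : point d m ∈ f.region)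
    (hm' : point d' m ∈ g.region) (h0 : (f.rayCorners d m v).Nonempty)
    (h1 : (g.rayCorners d' m v).Nonempty) : f.color d = g.color d' := by
  obtain ⟨r₀, hr₀, hle⟩ := Set.exists_min_image _ id (f.finite_rayCorners d m hv) h0
  obtain ⟨r₁, hr₁, hle'⟩ := Set.exists_min_image _ id (g.finite_rayCorners d' m hv) h1
  rcases le_total r₀ r₁ with h | h
  · exact f.color_eq_of_isLeast g hf hg hd hms hm hm' hr₀ hr₁ hle fun r hr => h.trans (hle' r hr)
  · exact (g.color_eq_of_isLeast f hg hf hd.symm hms hm' hm hr₁ hr₀ hle'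
      fun r hr => h.trans (hle r hr)).symm

theorem rayCorners_nonempty (f : UnfoldedFacet F) {d : LatticeDart} {q q' m : ℝ × ℝ} (hne : q ≠ q')
    (hq : point d q ∈ f.hull) (hq' : point d q' ∈ f.hull) (hm : m ∈ openSegment ℝ q q')
    (hmr : point d m ∈ f.region) (hmi : point d m ∉ interior f.hull) :
    (f.rayCorners d m (q' - q)).Nonempty := by
  have hsub : point d q' - point d q = (q' - q).1 • toPlane (unit d.2) +
      (q' - q).2 • toPlane (unit (d.2 + 1)) := by
    have := point_add_smul d q (q' - q) 1
    rw [one_smul, add_sub_cancel, one_smul] at this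
    rw [this, add_sub_cancel_left]
  have hm' : point d m ∈ openSegment ℝ (point d q) (point d q') := by
    obtain ⟨α, β, hα, hβ, hαβ, rfl⟩ := hm
    refine ⟨α, β, hα, hβ, hαβ, ?_⟩
    obtain rfl : α = 1 - β := by linarith
    have e : (1 - β) • q + β • q' = q + β • (q' - q) := by module
    rw [e, point_add_smul, ← hsub]
    module
  obtain ⟨i, r, hr, hi⟩ := exists_corner_of_notMem_interior (fun i => toPlane (f.corner i))
    f.interior_hull_nonempty hq hq' (fun h => hne (point_injective d h)) hm' hmi
    fun i hi => hmr.2 ⟨i, hi⟩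
  exact ⟨r, hr, i, by rw [point_add_smul, ← hsub]; exact hi⟩

end UnfoldedFacet

/-! ### Gluing the colourings of the facets -/

namespace Eisenstein

/-- A proper segment in a unit triangle has no lattice points inside. -/
theorem toPlane_notMem_openSegment {q q' : ℝ × ℝ} (hne : q ≠ q') (hq : q ∈ simplex)
    (hq' : q' ∈ simplex) (w : ℤ × ℤ) : toPlane w ∉ openSegment ℝ q q' := by
  rintro ⟨α, β, hα, hβ, hαβ, h⟩
  have hw := convex_simplex hq hq' hα.le hβ.le hαβ
  rw [h] at hw
  obtain ⟨w1, w2, w3⟩ := hw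
  simp only [toPlane] at w1 w2 w3
  have i1 : 0 ≤ w.1 := by exact_mod_cast w1
  have i2 : 0 ≤ w.2 := by exact_mod_cast w2
  have i3 : w.1 + w.2 ≤ 1 := by exact_mod_cast w3
  obtain ⟨a1, a2, a3⟩ := hq
  obtain ⟨b1, b2, b3⟩ := hq'
  simp only [toPlane, Prod.ext_iff, Prod.fst_add, Prod.snd_add, Prod.smul_fst, Prod.smul_snd,
    smul_eq_mul] at h
  obtain ⟨h1, h2⟩ := h
  -- A sum of nonnegative terms with positive weights vanishes only if all terms do.
  have hzero : ∀ x y : ℝ, 0 ≤ x → 0 ≤ y → α * x + β * y = 0 → x = 0 ∧ y = 0 := by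
    intro x y hx hy hxy
    have := mul_nonneg hα.le hx
    have := mul_nonneg hβ.le hy
    exact ⟨(mul_eq_zero.1 (by linarith)).resolve_left hα.ne',
      (mul_eq_zero.1 (by linarith)).resolve_left hβ.ne'⟩
  have hcases : (w.1 = 0 ∧ w.2 = 0) ∨ (w.1 = 1 ∧ w.2 = 0) ∨ (w.1 = 0 ∧ w.2 = 1) := by omega
  apply hne
  rcases hcases with ⟨e1, e2⟩ | ⟨e1, e2⟩ | ⟨e1, e2⟩ <;> rw [e1] at h1 <;> rw [e2] at h2 <;>
    push_cast at h1 h2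
  · have c1 := hzero _ _ a1 b1 h1
    have c2 := hzero _ _ a2 b2 h2
    ext <;> linarith
  · have c1 := hzero _ _ a2 b2 h2
    have c2 := hzero (1 - q.1) (1 - q'.1) (by linarith) (by linarith) (by linarith)
    ext <;> linarith
  · have c1 := hzero _ _ a1 b1 h1
    have c2 := hzero (1 - q.2) (1 - q'.2) (by linarith) (by linarith) (by linarith)
    ext <;> linarith

end Eisenstein

namespace MasterPolyhedron

open Eisenstein

variable {F : CubicMap} (P : MasterPolyhedron F)

/-- If a point inside a common segment of two facets is interior to one of them, then the facets and
their positions are the same. -/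
theorem color_eq_of_mem_interior {f g : P.Facet} {d d' : LatticeDart}
    (hd : (P.facet f).unfold d = (P.facet g).unfold d') {q q' m : ℝ × ℝ} (hne : q ≠ q')
    (hq : q ∈ simplex) (hq' : q' ∈ simplex) (hm : m ∈ openSegment ℝ q q')
    (hf : ∀ x ∈ openSegment ℝ q q', point d x ∈ (P.facet f).region)
    (hg : ∀ x ∈ openSegment ℝ q q', point d' x ∈ (P.facet g).region)
    (hmi : point d m ∈ interior (P.facet f).hull) :
    (P.facet f).color d = (P.facet g).color d' := by
  have hdisj : ∀ x ∈ openSegment ℝ q q', point d x ∈ interior (P.facet f).hull →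
      f = g ∧ point d x = point d' x := by
    intro x hx hxi
    have hxs := convex_simplex.openSegment_subset hq hq' hx
    exact P.disjoint f g _ _ _ x hxi ⟨hf x hx, hxs, d, rfl, rfl⟩ ⟨hg x hx, hxs, d', hd.symm, rfl⟩
  obtain ⟨rfl, h1⟩ := hdisj m hm hmi
  obtain ⟨x, hx, hxm⟩ : ∃ x ∈ openSegment ℝ q q' ∩ point d ⁻¹' interior (P.facet f).hull,
      m ≠ x := by
    obtain ⟨α, β, hα, hβ, hαβ, rfl⟩ := hm
    obtain rfl : α = 1 - β := by linarith
    have hcont : Continuous fun t : ℝ => point d ((1 - t) • q + t • q') :=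
      (continuous_point d).comp (by fun_prop)
    have hopen : IsOpen (Set.Ioo 0 1 ∩ {t : ℝ | point d ((1 - t) • q + t • q') ∈
        interior (P.facet f).hull}) := isOpen_Ioo.inter (isOpen_interior.preimage hcont)
    have hnhds := hopen.mem_nhds (x := β) ⟨⟨hβ, by linarith⟩, hmi⟩
    obtain ⟨t, ⟨⟨ht, ht'⟩, hti⟩, hne'⟩ :=
      ((infinite_of_mem_nhds β hnhds).sdiff (Set.finite_singleton β)).nonempty
    refine ⟨(1 - t) • q + t • q', ⟨⟨1 - t, t, by linarith, ht, by ring, rfl⟩, hti⟩, ?_⟩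
    intro h
    have h2 : (t - β) • (q' - q) = 0 := by
      rw [← sub_eq_zero] at h
      rw [← neg_eq_zero, ← h]
      module
    rcases smul_eq_zero.1 h2 with h2 | h2
    · exact hne' (sub_eq_zero.1 h2)
    · exact hne (sub_eq_zero.1 h2).symm
  rw [eq_of_point_eq hxm h1 (hdisj x hx.1 hx.2).2]

/-- Two facets with a common segment inside a triangle of the surface induce the same colour on this
triangle. -/
theorem color_eq_of_segment (hP : ∀ f i, residue ((P.facet f).side i) = 0) {f g : P.Facet}
    {d d' : LatticeDart} (hd : (P.facet f).unfold d = (P.facet g).unfold d') {q q' : ℝ × ℝ}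
    (hne : q ≠ q') (hq : q ∈ simplex) (hq' : q' ∈ simplex)
    (hfq : point d q ∈ (P.facet f).hull) (hfq' : point d q' ∈ (P.facet f).hull)
    (hgq : point d' q ∈ (P.facet g).hull) (hgq' : point d' q' ∈ (P.facet g).hull) :
    (P.facet f).color d = (P.facet g).color d' := by
  have hregion : ∀ (f : UnfoldedFacet F) (d : LatticeDart), point d q ∈ f.hull →
      point d q' ∈ f.hull → ∀ x ∈ openSegment ℝ q q', point d x ∈ f.region := by
    rintro f d h h' x hx
    refine ⟨?_, ?_⟩
    · obtain ⟨α, β, hα, hβ, hαβ, rfl⟩ := hx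
      convert! f.convex_hull h h' hα.le hβ.le hαβ using 1
      obtain rfl : α = 1 - β := by linarith
      simp only [point, Prod.fst_add, Prod.snd_add, Prod.smul_fst, Prod.smul_snd, smul_eq_mul]
      module
    · rintro ⟨i, hi⟩
      obtain ⟨w, hw⟩ := exists_latticePoint_eq d (f.corner i)
      simp only [← hw, toPlane_latticePoint] at hi
      rw [← point_injective d hi] at hx
      exact toPlane_notMem_openSegment hne hq hq' w hx
  have hf := hregion _ d hfq hfq'
  have hg := hregion _ d' hgq hgq'
  obtain ⟨m, hm⟩ : (openSegment ℝ q q').Nonempty :=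
    ⟨_, 1 / 2, 1 / 2, by norm_num, by norm_num, by norm_num, rfl⟩
  by_cases h1 : point d m ∈ interior (P.facet f).hull
  · exact P.color_eq_of_mem_interior hd hne hq hq' hm hf hg h1
  by_cases h2 : point d' m ∈ interior (P.facet g).hull
  · exact (P.color_eq_of_mem_interior hd.symm hne hq hq' hm hg hf h2).symm
  exact (P.facet f).color_eq_of_rayCorners (P.facet g) (hP f) (hP g) hd
    (convex_simplex.openSegment_subset hq hq' hm) (sub_ne_zero.2 hne.symm) (hf m hm) (hg m hm)
    ((P.facet f).rayCorners_nonempty hne hfq hfq' hm (hf m hm) h1)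
    ((P.facet g).rayCorners_nonempty hne hgq hgq' hm (hg m hm) h2)

/-- The facets induce on a triangle of the surface the same colour at all but finitely many points.
Outside the finitely many isolated common points of two facets in this triangle, the parts of it with
different colours are disjoint, closed and cover a connected set. -/
theorem exists_color (hP : ∀ f i, residue ((P.facet f).side i) = 0) (δ : F.Dart) :
    ∃ E : Set (ℝ × ℝ), E.Finite ∧ ∃ t : ZMod 3, ∀ f d q, (P.facet f).unfold d = δ →
      q ∈ simplex → q ∉ E → point d q ∈ (P.facet f).region → (P.facet f).color d = t := by
  have := P.finite
  let K : P.Facet × LatticeDart → Set (ℝ × ℝ) := fun j =>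
    simplex ∩ point j.2 ⁻¹' (P.facet j.1).hull
  let J : Set (P.Facet × LatticeDart) := {j | (P.facet j.1).unfold j.2 = δ ∧ (K j).Nonempty}
  have hJ : J.Finite := by
    have h : (⋃ f : P.Facet, Prod.mk f ''
        {d | (triangle d ∩ (P.facet f).hull).Nonempty}).Finite :=
      Set.finite_iUnion fun f => (locallyFinite_triangle.finite_nonempty_inter_compact
        (P.facet f).isCompact_hull).image _
    refine h.subset ?_
    rintro ⟨f, d⟩ ⟨-, q, hq, hq'⟩
    exact Set.mem_iUnion.2 ⟨f, d, ⟨_, ⟨q, hq, rfl⟩, hq'⟩, rfl⟩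
  have hK : ∀ j, IsClosed (K j) := fun j =>
    isCompact_simplex.isClosed.inter
      ((P.facet j.1).isCompact_hull.isClosed.preimage (continuous_point _))
  let E : Set (ℝ × ℝ) := {(0, 0), (1, 0), (0, 1)} ∪
    ⋃ p ∈ {p ∈ J ×ˢ J | (K p.1 ∩ K p.2).Subsingleton}, K p.1 ∩ K p.2
  have hE : E.Finite := by
    refine (Set.toFinite _).union (((hJ.prod hJ).subset (Set.sep_subset _ _)).biUnion ?_)
    rintro p ⟨-, hp⟩
    exact hp.finite
  have hcover : ∀ q ∈ simplex \ E, ∃ j ∈ J, q ∈ K j := by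
    rintro q ⟨hq, hqE⟩
    have hq0 : q ∉ ({(0, 0), (1, 0), (0, 1)} : Set (ℝ × ℝ)) := fun h => hqE (Or.inl h)
    simp only [Set.mem_insert_iff, Set.mem_singleton_iff, not_or] at hq0
    obtain ⟨f, p, hp, -, d, hd, rfl⟩ := P.cover δ q hq hq0.1 hq0.2.1 hq0.2.2
    exact ⟨(f, d), ⟨hd, q, hq, hp.1⟩, hq, hp.1⟩
  by_cases hne : (simplex \ E).Nonempty
  · obtain ⟨q₀, hq₀⟩ := hne
    obtain ⟨j₀, hj₀, hqj₀⟩ := hcover q₀ hq₀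
    refine ⟨E, hE, (P.facet j₀.1).color j₀.2, fun f d q hd hq hqE hr => ?_⟩
    by_contra hcol
    have hj : (f, d) ∈ J := ⟨hd, q, hq, hr.1⟩
    have hclosed : ∀ R : P.Facet × LatticeDart → Prop, IsClosed (⋃ j ∈ {j ∈ J | R j}, K j) :=
      fun R => (hJ.subset (Set.sep_subset _ _)).isClosed_biUnion fun j _ => hK j
    obtain ⟨x, hx, hx1, hx2⟩ := isPreconnected_closed_iff.1 (isPreconnected_simplex_diff hE) _ _
      (hclosed fun j => (P.facet j.1).color j.2 = (P.facet j₀.1).color j₀.2)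
      (hclosed fun j => (P.facet j.1).color j.2 ≠ (P.facet j₀.1).color j₀.2)
      (fun x hx => by
        obtain ⟨j, hj, hxj⟩ := hcover x hx
        by_cases hc : (P.facet j.1).color j.2 = (P.facet j₀.1).color j₀.2
        · exact Or.inl (Set.mem_biUnion (show j ∈ {j ∈ J | _} from ⟨hj, hc⟩) hxj)
        · exact Or.inr (Set.mem_biUnion (show j ∈ {j ∈ J | _} from ⟨hj, hc⟩) hxj))
      ⟨q₀, hq₀, Set.mem_biUnion (show j₀ ∈ {j ∈ J | _} from ⟨hj₀, rfl⟩) hqj₀⟩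
      ⟨q, ⟨hq, hqE⟩, Set.mem_biUnion (show (f, d) ∈ {j ∈ J | _} from ⟨hj, hcol⟩) ⟨hq, hr.1⟩⟩
    obtain ⟨j, ⟨hjJ, hjc⟩, hxj⟩ := Set.mem_iUnion₂.1 hx1
    obtain ⟨l, ⟨hlJ, hlc⟩, hxl⟩ := Set.mem_iUnion₂.1 hx2
    have hns : ¬ (K j ∩ K l).Subsingleton := fun hs =>
      hx.2 (Or.inr (Set.mem_biUnion (x := (j, l)) ⟨⟨hjJ, hlJ⟩, hs⟩ ⟨hxj, hxl⟩))
    obtain ⟨y, hy, z, hz, hyz⟩ := Set.not_subsingleton_iff.1 hns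
    exact hlc ((P.color_eq_of_segment hP (hlJ.1.trans hjJ.1.symm) hyz hy.1.1 hz.1.1 hy.2.2 hz.2.2
      hy.1.2 hz.1.2).trans hjc)
  · exact ⟨E, hE, 0, fun f d q _ hq hqE => absurd ⟨q, hq, hqE⟩ hne⟩

theorem exists_isColoring (hP : ∀ f i, residue ((P.facet f).side i) = 0) :
    ∃ c, F.IsColoring c := by
  choose E hE c hc using P.exists_color hP
  -- A point inside an edge that is generic for both darts in question.
  have hgen : ∀ (δ δ' : F.Dart) (φ : ℝ → ℝ × ℝ), Function.Injective φ →
      ∃ x : ℝ, 0 < x ∧ x < 1 ∧ (x, 0) ∉ E δ ∧ φ x ∉ E δ' := by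
    intro δ δ' φ hφ
    have hinj : Function.Injective fun x : ℝ => (x, (0 : ℝ)) := fun x y h => congrArg Prod.fst h
    obtain ⟨x, hx, hxE⟩ := ((Set.Ioo_infinite (zero_lt_one' ℝ)).sdiff
      (((hE δ).preimage hinj.injOn).union ((hE δ').preimage hφ.injOn))).nonempty
    exact ⟨x, hx.1, hx.2, fun h => hxE (Or.inl h), fun h => hxE (Or.inr h)⟩
  have hmem : ∀ x : ℝ, 0 < x → x < 1 → (x, (0 : ℝ)) ∈ simplex := fun x h h' =>
    ⟨h.le, le_rfl, by simpa using h'.le⟩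
  have hrep : ∀ δ (x : ℝ), 0 < x → x < 1 → ∃ f d, (P.facet f).unfold d = δ ∧
      point d (x, 0) ∈ (P.facet f).region := by
    intro δ x h h'
    obtain ⟨f, p, hp, -, d, hd, rfl⟩ := P.cover δ (x, 0) (hmem x h h')
      (fun e => h.ne' (congrArg Prod.fst e)) (fun e => h'.ne (congrArg Prod.fst e))
      (fun e => h.ne' (congrArg Prod.fst e))
    exact ⟨f, d, hd, hp⟩
  refine ⟨c, fun δ => ?_, fun δ => ?_⟩
  · obtain ⟨x, h0, h1, hx, hx'⟩ := hgen δ (F.vert δ) (fun x => (0, 1 - x)) fun x y h => by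
      simpa using congrArg Prod.snd h
    obtain ⟨f, d, rfl, hp⟩ := hrep δ x h0 h1
    have hn : point (next d) (0, 1 - x) = point d (x, 0) := by
      rw [point_next]
      simp
    rw [← hc _ f d (x, 0) rfl (hmem x h0 h1) hx hp, ← hc _ f (next d) (0, 1 - x)
      ((P.facet f).unfold_next ⟨_, ⟨_, hmem x h0 h1, rfl⟩, hp⟩)
      ⟨le_rfl, by simpa using h1.le, by simpa using h0.le⟩ hx' (by rwa [hn]),
      UnfoldedFacet.color, latticeColor_next]
    rfl
  · obtain ⟨x, h0, h1, hx, hx'⟩ := hgen δ (F.flip δ) (fun x => (1 - x, 0)) fun x y h => by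
      simpa using congrArg Prod.fst h
    obtain ⟨f, d, rfl, hp⟩ := hrep δ x h0 h1
    have hn : point (Eisenstein.flip d) (1 - x, 0) = point d (x, 0) := by
      rw [point_flip]
      simp
    rw [← hc _ f d (x, 0) rfl (hmem x h0 h1) hx hp, ← hc _ f (Eisenstein.flip d) (1 - x, 0)
      ((P.facet f).unfold_flip ⟨_, ⟨_, ⟨hmem x h0 h1, rfl⟩, rfl⟩, hp⟩)
      (hmem _ (by linarith) (by linarith)) hx' (by rwa [hn]),
      UnfoldedFacet.color, latticeColor_flip]
    rfl

end MasterPolyhedron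

theorem theorem2 (F : CubicMap) (hF : F.IsFullerene) (P : MasterPolyhedron F) :
    F.IsLeapfrog ↔
      ∀ (f : P.Facet) (i : Fin ((P.facet f).extra + 3)) (a b : ℕ),
        Eisenstein.IsCoxeter ((P.facet f).side i) a b → a ≡ b [MOD 3] := by
  rw [CubicMap.isLeapfrog_iff_exists_isColoring hF]
  constructor
  · rintro ⟨c, hc⟩ f i a b hab
    exact hab.modEq_iff.2 ((P.facet f).residue_side_eq_zero hc i)
  · intro h
    refine P.exists_isColoring fun f i => ?_
    obtain ⟨a, b, hab⟩ := Eisenstein.exists_isCoxeter ((P.facet f).side i)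
    exact hab.modEq_iff.1 (h f i a b hab)
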